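/- Let $n\ge 2$. For $\pi\in S_n$ let the down degree $d_-(\pi)$ be the number of permutations covered by $\pi$ in the strong Bruhat order on $S_n$, let the up degree $d_+(\pi)$ be the number of permutations covering $\pi$, and let $d(\pi)=d_-(\pi)+d_+(\pi)$ be the total degree, i.e. the valency of $\pi$ in the Hasse diagram of the strong Bruhat order. Then $$ \#\{\pi\in S_n \mid d(\pi)=\lfloor n^2/4\rfloor+n-2\}=\begin{cases}2,& n=2;\\ 4,& n=3\text{ or }n=4;\\ 8,& n\ge 6\text{ even};\\ 16,& n\ge 5\text{ odd}.\end{cases} $$ Moreover, a permutation $\pi\in S_n$ satisfies $d(\pi)=\lfloor n^2/4\rfloor+n-2$ if and only if it is one of the permutations $$ \pi_0=[m+1,m+2,\ldots,n,1,2,\ldots,m]\qquad (m\in\{\lfloor n/2\rfloor,\lceil n/2\rceil\}) $$ (written as sequences of values $[\pi(1),\ldots,\pi(n)]$), or is obtained from one of them by finitely many applications of the following operations: $\pi\mapsto\pi^r=[\pi(n),\pi(n-1),\ldots,\pi(1)]$; $\pi\mapsto\pi^s$, interchanging $\pi(1)$ and $\pi(n)$; $\pi\mapsto\pi^t$, interchanging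 the values $1$ and $n$ in $\pi$. These permutations are exactly the extremal ones, i.e. those whose total degree is the maximum of $d$ over $S_n$. -/

import Mathlib

namespace StrongBruhat

open Equiv

/-! Permutations in `S_n` are elements of `Perm (Fin n)`: the positions and the values
`1, …, n` are shifted to `0, …, n - 1`, and `(π * σ) i = π (σ i)`. -/

/-- The standard Coxeter generators of `S_n`: the transpositions of two consecutive elements. -/
def IsSimple {n : ℕ} (s : Perm (Fin n)) : Prop :=
  ∃ i j : Fin n, (j : ℕ) = (i : ℕ) + 1 ∧ s = swap i j

/-- The length of `π`: the least number of factors in an expression of `π` as a product of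
standard Coxeter generators. -/
noncomputable def length {n : ℕ} (π : Perm (Fin n)) : ℕ :=
  sInf {k : ℕ | ∃ w : List (Perm (Fin n)), (∀ s ∈ w, IsSimple s) ∧ w.prod = π ∧ w.length = k}

/-- One step upwards: multiplication by a transposition that increases the length. -/
def Step {n : ℕ} (σ π : Perm (Fin n)) : Prop :=
  ∃ t : Perm (Fin n), t.IsSwap ∧ π = t * σ ∧ length σ < length π

theorem eq_or_length_lt {n : ℕ} {σ π : Perm (Fin n)} (h : Relation.ReflTransGen Step σ π) :
    σ = π ∨ length σ < length π := by
  induction h with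
  | refl => exact Or.inl rfl
  | tail _ hs ih =>
    obtain ⟨t, _, _, hlt⟩ := hs
    rcases ih with rfl | ih
    · exact Or.inr hlt
    · exact Or.inr (ih.trans hlt)

/-- The strong Bruhat order on `S_n`: the reflexive and transitive closure of `Step`. -/
instance bruhatOrder (n : ℕ) : PartialOrder (Perm (Fin n)) where
  le σ π := Relation.ReflTransGen Step σ π
  le_refl _ := Relation.ReflTransGen.refl
  le_trans _ _ _ h₁ h₂ := Relation.ReflTransGen.trans h₁ h₂
  le_antisymm σ π h₁ h₂ := by
    rcases eq_or_length_lt h₁ with h | h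
    · exact h
    · rcases eq_or_length_lt h₂ with h' | h'
      · exact h'.symm
      · exact absurd (h.trans h') (lt_irrefl _)

/-- The down degree: the number of permutations covered by `π` in the strong Bruhat order. -/
noncomputable def downDegree {n : ℕ} (π : Perm (Fin n)) : ℕ :=
  {σ : Perm (Fin n) | σ ⋖ π}.ncard

/-- The up degree: the number of permutations that cover `π` in the strong Bruhat order. -/
noncomputable def upDegree {n : ℕ} (π : Perm (Fin n)) : ℕ :=
  {σ : Perm (Fin n) | π ⋖ σ}.ncard

/-- The total degree, i.e. the valency of `π` in the Hasse diagram of the strong Bruhat order. -/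
noncomputable def totalDegree {n : ℕ} (π : Perm (Fin n)) : ℕ :=
  downDegree π + upDegree π

/-- A permutation is extremal if its total degree is the largest one in `S_n`. -/
def IsExtremal {n : ℕ} (π : Perm (Fin n)) : Prop :=
  ∀ σ : Perm (Fin n), totalDegree σ ≤ totalDegree π

/-- The permutation `[m+1, m+2, …, n, 1, 2, …, m]` of `S_n`. -/
def blockPerm (n m : ℕ) (hm : m ≤ n) : Perm (Fin n) where
  toFun i := if h : (i : ℕ) < n - m then ⟨m + i, by omega⟩ else ⟨i - (n - m), by omega⟩
  invFun j := if h : (j : ℕ) < m then ⟨(n - m) + j, by omega⟩ else ⟨j - m, by omega⟩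
  left_inv i := by
    have hi := i.isLt
    ext
    by_cases h : (i : ℕ) < n - m
    · simp [h]
    · have h' : (i : ℕ) - (n - m) < m := by omega
      simp only [h, h', dif_neg, dif_pos, not_false_eq_true]
      omega
  right_inv j := by
    have hj := j.isLt
    ext
    by_cases h : (j : ℕ) < m
    · simp [h]
    · have h' : (j : ℕ) - m < n - m := by omega
      simp only [h, h', dif_neg, dif_pos, not_false_eq_true]
      omega

/-- The transposition `t_{1,n}` of the smallest and the largest element. -/
def endsSwap (n : ℕ) (hn : 2 ≤ n) : Perm (Fin n) :=
  swap ⟨0, by omega⟩ ⟨n - 1, by omega⟩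

/-- The permutations obtained from `[m+1, …, n, 1, …, m]` with `m = ⌊n/2⌋` or `m = ⌈n/2⌉` by
applying any number (possibly zero) of the three operations `π ↦ π^r, π^s, π^t`, in any order. -/
inductive HasExtremalForm (n : ℕ) (hn : 2 ≤ n) : Perm (Fin n) → Prop
  /-- The permutation for `m = ⌊n/2⌋`. -/
  | floor : HasExtremalForm n hn (blockPerm n (n / 2) (by omega))
  /-- The permutation for `m = ⌈n/2⌉`. -/
  | ceil : HasExtremalForm n hn (blockPerm n ((n + 1) / 2) (by omega))
  /-- Reversing the sequence of values: `[π(n), …, π(1)]`. -/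
  | reverse (π : Perm (Fin n)) :
      HasExtremalForm n hn π → HasExtremalForm n hn (π * Fin.revPerm)
  /-- Interchanging `π(1)` and `π(n)`. -/
  | swapEnds (π : Perm (Fin n)) :
      HasExtremalForm n hn π → HasExtremalForm n hn (π * endsSwap n hn)
  /-- Interchanging the values `1` and `n`. -/
  | swapValues (π : Perm (Fin n)) :
      HasExtremalForm n hn π → HasExtremalForm n hn (endsSwap n hn * π)

end StrongBruhat

/-!
The permutations covered by `π` or covering `π` correspond to the pairs of points of the graph
`{(i, π i)}` whose axis-parallel rectangle contains no further point of the graph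
(`covBy_iff`, `totalDegree_eq`). So the total degree is the number of edges of the
empty-rectangle graph of `n` points in general position, and the theorem is about the maximum
`⌊n²/4⌋ + n - 2` of that number and the configurations that attain it.

*Upper bound* (`adjCount_le_edgeBound`). Let `L` be the leftmost point and `v` its neighbour
furthest to the right. On either side of the height of `L`, the neighbours of `L` form a monotone
chain, and `v` is adjacent to at most one point of it; so `L` and `v` have at most two common
neighbours, their degrees add up to at most `n + 2`, and deleting both points costs at most `n + 1`
edges. The bound follows by induction from `n - 2` to `n`.

*Extremal configurations.* If the bound is attained, the same count shows that any two adjacent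
points have at least two common neighbours (`IsMaximal.two_le_card_common`), that every degree
exceeds `⌊n/2⌋` (`IsMaximal.half_lt_deg`), that every point is adjacent to `L` or `v`, and that the
configuration without `L` and `v` is extremal and loses no edges. From this, by induction, the
leftmost point `L` and the rightmost point `R` are adjacent, and so are the highest point `T` and the
lowest point `B` (`IsMaximal.adj_left_right`). Hence the heights of `L` and `R` are consecutive, as
are the positions of `T` and `B`, and the other points lie in four quadrants. As each of `L`, `R`
is adjacent to `T` or `B`, only two opposite quadrants can be inhabited (`Frame.oriented_or`), and
each of them is a monotone chain (`Frame.upper_left_chain`). Up to a reversal and up to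
interchanging the consecutive heights of `L` and `R` and the consecutive positions of `T` and `B`,
which changes no edge, this is a block permutation (`eq_blockPerm`), and the degrees of `L` and `R`
force the two blocks to differ by at most one in size.

Conversely the balanced block permutations have enough edges (`le_totalDegree_blockPerm`), and the
three operations preserve extremality. They commute and are involutions, so there are at most `8`
or `16` extremal permutations; for `n ≥ 6` a few values tell them apart
(`extremalPerm_injective`).
-/

namespace StrongBruhat

open Finset Equiv

/-! ### Empty-rectangle graphs -/

/-- `c` lies strictly between `a` and `b`, in either order. -/
def Between (a b c : ℤ) : Prop := (a < c ∧ c < b) ∨ (b < c ∧ c < a)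

/-- The empty-rectangle graph of a finite set `S` of points with coordinate functions `x` and `y`:
two points are adjacent if no point of `S` lies strictly inside the axis-parallel rectangle that
they span. The points are elements of an arbitrary type, so that reflecting a coordinate or
exchanging the two coordinates changes `x` and `y` only, and neither `S` nor its subsets. -/
def Adj {V : Type*} (x y : V → ℤ) (S : Finset V) (u v : V) : Prop :=
  u ≠ v ∧ ∀ w ∈ S, Between (x u) (x v) (x w) → ¬ Between (y u) (y v) (y w)

open Classical in
/-- The neighbours of `u` in the empty-rectangle graph of `S`. -/
noncomputable def nbrs {V : Type*} (x y : V → ℤ) (S : Finset V) (u : V) : Finset V :=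
  S.filter (Adj x y S u)

open Classical in
/-- The number of ordered pairs of points of `T` that are adjacent in the empty-rectangle graph
of `S`. Thus `adjCount x y S S` is twice the number of edges of that graph. -/
noncomputable def adjCount {V : Type*} (x y : V → ℤ) (S T : Finset V) : ℕ :=
  ((T ×ˢ T).filter fun p => Adj x y S p.1 p.2).card

/-- The largest number of edges of the empty-rectangle graph of `n ≥ 2` points. -/
def edgeBound (n : ℕ) : ℕ := n ^ 2 / 4 + n - 2

theorem edgeBound_add_two {n : ℕ} (hn : 2 ≤ n) : edgeBound (n + 2) = edgeBound n + n + 3 := by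
  unfold edgeBound
  have : (n + 2) ^ 2 = n ^ 2 + 4 * (n + 1) := by ring
  omega

theorem edgeBound_succ {n : ℕ} (hn : 2 ≤ n) :
    edgeBound (n + 1) = edgeBound n + (n + 1) / 2 + 1 := by
  unfold edgeBound
  obtain ⟨k, rfl | rfl⟩ := n.even_or_odd'
  · have h₁ : (2 * k + 1) ^ 2 = 4 * (k ^ 2 + k) + 1 := by ring
    have h₂ : (2 * k) ^ 2 = 4 * k ^ 2 := by ring
    omega
  · have h₁ : (2 * k + 1 + 1) ^ 2 = 4 * (k ^ 2 + 2 * k + 1) := by ring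
    have h₂ : (2 * k + 1) ^ 2 = 4 * (k ^ 2 + k) + 1 := by ring
    omega

section Graph

variable {V : Type*} {x y : V → ℤ} {S T : Finset V} {u v w : V}

theorem Adj.symm (h : Adj x y S u v) : Adj x y S v u := by
  refine ⟨h.1.symm, fun w hw => ?_⟩
  have := h.2 w hw
  unfold Between at *
  omega

theorem adj_comm : Adj x y S u v ↔ Adj x y S v u := ⟨Adj.symm, Adj.symm⟩

theorem Adj.mono (h : Adj x y S u v) (hT : T ⊆ S) : Adj x y T u v :=
  ⟨h.1, fun w hw => h.2 w (hT hw)⟩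

theorem Adj.swap (h : Adj x y S u v) : Adj y x S u v :=
  ⟨h.1, fun w hw h₁ h₂ => h.2 w hw h₂ h₁⟩

theorem adj_swap : Adj y x S u v ↔ Adj x y S u v := ⟨Adj.swap, Adj.swap⟩

theorem between_neg {a b c : ℤ} : Between (-a) (-b) (-c) ↔ Between a b c := by
  unfold Between
  omega

theorem adj_neg_right : Adj x (fun v => -y v) S u v ↔ Adj x y S u v := by
  simp only [Adj, between_neg]

theorem adj_neg_left : Adj (fun v => -x v) y S u v ↔ Adj x y S u v := by
  simp only [Adj, between_neg]

theorem not_adj_of_between (hw : w ∈ S) (h₁ : Between (x u) (x v) (x w))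
    (h₂ : Between (y u) (y v) (y w)) : ¬ Adj x y S u v :=
  fun h => h.2 w hw h₁ h₂

theorem exists_between_of_not_adj (huv : u ≠ v) (h : ¬ Adj x y S u v) :
    ∃ w ∈ S, Between (x u) (x v) (x w) ∧ Between (y u) (y v) (y w) := by
  by_contra hc
  push Not at hc
  exact h ⟨huv, hc⟩

theorem mem_nbrs : v ∈ nbrs x y S u ↔ v ∈ S ∧ Adj x y S u v := by
  simp [nbrs]

theorem adjCount_swap : adjCount y x S T = adjCount x y S T := by
  unfold adjCount
  congr 1
  ext p
  simp only [mem_filter, adj_swap]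

theorem adjCount_neg_right : adjCount x (fun v => -y v) S T = adjCount x y S T := by
  unfold adjCount
  congr 1
  ext p
  simp only [mem_filter, adj_neg_right]

theorem adjCount_neg_left : adjCount (fun v => -x v) y S T = adjCount x y S T := by
  unfold adjCount
  congr 1
  ext p
  simp only [mem_filter, adj_neg_left]

open Classical in
theorem adjCount_insert (hu : u ∉ T) : adjCount x y S (insert u T) =
    adjCount x y S T + 2 * (T.filter (Adj x y S u)).card := by
  have key : ∀ T : Finset V, adjCount x y S T =
      ∑ a ∈ T, ∑ b ∈ T, if Adj x y S a b then 1 else 0 := by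
    intro T
    rw [adjCount, card_filter, sum_product]
  have hself : ¬ Adj x y S u u := fun h => h.1 rfl
  have hc : ∑ a ∈ T, (if Adj x y S a u then 1 else 0) = (T.filter (Adj x y S u)).card := by
    rw [card_filter]
    simp only [adj_comm (u := u)]
  have hc' : ∑ a ∈ T, (if Adj x y S u a then 1 else 0) = (T.filter (Adj x y S u)).card := by
    rw [card_filter]
  rw [key, key, sum_insert hu]
  simp only [sum_insert hu, sum_add_distrib, hc, hc', if_neg hself]
  omega

open Classical in
theorem adjCount_erase (hu : u ∈ S) :
    adjCount x y S S = adjCount x y S (S.erase u) + 2 * (nbrs x y S u).card := by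
  have h := adjCount_insert (x := x) (y := y) (S := S) (notMem_erase u S)
  rw [insert_erase hu] at h
  rw [h]
  congr 3
  ext a
  simp only [mem_filter, mem_erase, mem_nbrs]
  exact ⟨fun h => ⟨h.1.2, h.2⟩, fun h => ⟨⟨h.2.1.symm, h.1⟩, h.2⟩⟩

open Classical in
theorem adjCount_erase_erase (hu : u ∈ S) (hv : v ∈ S) (h : Adj x y S u v) :
    adjCount x y S S + 2 = adjCount x y S ((S.erase u).erase v) +
      2 * ((nbrs x y S u).card + (nbrs x y S v).card) := by
  have hv' : v ∈ S.erase u := mem_erase.2 ⟨h.1.symm, hv⟩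
  have h₁ := adjCount_insert (x := x) (y := y) (S := S) (notMem_erase v (S.erase u))
  rw [insert_erase hv'] at h₁
  have h₂ : nbrs x y S v = insert u (((S.erase u).erase v).filter (Adj x y S v)) := by
    ext a
    simp only [mem_insert, mem_filter, mem_erase, mem_nbrs]
    constructor
    · rintro ⟨ha, hva⟩
      by_cases hau : a = u
      · exact Or.inl hau
      · exact Or.inr ⟨⟨hva.1.symm, hau, ha⟩, hva⟩
    · rintro (rfl | ⟨⟨-, -, ha⟩, hva⟩)
      · exact ⟨hu, h.symm⟩
      · exact ⟨ha, hva⟩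
  have h₃ : u ∉ ((S.erase u).erase v).filter (Adj x y S v) := by simp
  have h₄ := adjCount_erase (x := x) (y := y) hu
  rw [h₂, card_insert_of_notMem h₃]
  omega

theorem adjCount_le (hT : T ⊆ S) : adjCount x y S T ≤ adjCount x y T T := by
  classical
  unfold adjCount
  exact card_le_card fun p hp => by
    rw [mem_filter] at hp ⊢
    exact ⟨hp.1, hp.2.mono hT⟩

theorem adj_of_adjCount_eq (hT : T ⊆ S) (h : adjCount x y T T ≤ adjCount x y S T) (hu : u ∈ T)
    (hv : v ∈ T) (huv : Adj x y T u v) : Adj x y S u v := by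
  classical
  have hsub : (T ×ˢ T).filter (fun p => Adj x y S p.1 p.2) ⊆
      (T ×ˢ T).filter (fun p => Adj x y T p.1 p.2) := fun p hp => by
    rw [mem_filter] at hp ⊢
    exact ⟨hp.1, hp.2.mono hT⟩
  unfold adjCount at h
  have heq := eq_of_subset_of_card_le hsub (by convert h)
  have hmem : (u, v) ∈ (T ×ˢ T).filter (fun p => Adj x y T p.1 p.2) := by
    simp [hu, hv, huv]
  rw [← heq, mem_filter] at hmem
  exact hmem.2

theorem adjCount_le_offDiag : adjCount x y S S ≤ S.card * S.card - S.card := by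
  classical
  rw [← offDiag_card]
  unfold adjCount
  exact card_le_card fun p hp => by
    rw [mem_filter, mem_product] at hp
    exact mem_offDiag.2 ⟨hp.1.1, hp.1.2, hp.2.1⟩

theorem adj_of_offDiag_le (h : S.card * S.card - S.card ≤ adjCount x y S S) (hu : u ∈ S)
    (hv : v ∈ S) (huv : u ≠ v) : Adj x y S u v := by
  classical
  have hsub : (S ×ˢ S).filter (fun p => Adj x y S p.1 p.2) ⊆ S.offDiag := fun p hp => by
    rw [mem_filter, mem_product] at hp
    exact mem_offDiag.2 ⟨hp.1.1, hp.1.2, hp.2.1⟩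
  rw [← offDiag_card] at h
  unfold adjCount at h
  have heq := eq_of_subset_of_card_le hsub (by convert h)
  have hmem : (u, v) ∈ S.offDiag := mem_offDiag.2 ⟨hu, hv, huv⟩
  rw [← heq, mem_filter] at hmem
  exact hmem.2

open Classical in
theorem card_nbrs_add_card_nbrs : (nbrs x y S u).card + (nbrs x y S v).card =
    (nbrs x y S u ∪ nbrs x y S v).card + (nbrs x y S u ∩ nbrs x y S v).card :=
  (card_union_add_card_inter _ _).symm

/-- The point `L` is the leftmost point of `S`. Reflecting and exchanging the coordinates
expresses the rightmost, the lowest and the highest point by the same predicate. -/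
def IsLeftmost (x : V → ℤ) (S : Finset V) (L : V) : Prop := L ∈ S ∧ ∀ w ∈ S, w ≠ L → x L < x w

theorem exists_isLeftmost (hx : Function.Injective x) (hS : S.Nonempty) :
    ∃ L, IsLeftmost x S L := by
  obtain ⟨L, hL, hmin⟩ := exists_min_image S x hS
  exact ⟨L, hL, fun w hw hne => lt_of_le_of_ne (hmin w hw) (fun h => hne (hx h).symm)⟩

/-- The neighbour of the leftmost point `L` that lies furthest to the right. -/
def IsLastNbr (x y : V → ℤ) (S : Finset V) (L v : V) : Prop :=
  v ∈ S ∧ Adj x y S L v ∧ ∀ w ∈ S, Adj x y S L w → w ≠ v → x w < x v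

theorem exists_isLastNbr (hx : Function.Injective x) {L : V} (hL : IsLeftmost x S L)
    (hS : 2 ≤ S.card) : ∃ v, IsLastNbr x y S L v := by
  classical
  have hne : (S.erase L).Nonempty := by
    rw [← card_pos, card_erase_of_mem hL.1]
    omega
  obtain ⟨a, ha, hmin⟩ := exists_isLeftmost hx hne
  have hadj : a ∈ nbrs x y S L := by
    refine mem_nbrs.2 ⟨(mem_erase.1 ha).2, (mem_erase.1 ha).1.symm, fun w hw hb => ?_⟩
    exfalso
    have h₁ := hL.2 w hw
    have h₂ := hmin w
    unfold Between at hb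
    by_cases hwL : w = L
    · subst hwL; omega
    · by_cases hwa : w = a
      · subst hwa; omega
      · have := h₂ (mem_erase.2 ⟨hwL, hw⟩) hwa
        have := hL.2 a (mem_erase.1 ha).2 (mem_erase.1 ha).1
        omega
  obtain ⟨v, hv, hmax⟩ := exists_max_image (nbrs x y S L) x ⟨a, hadj⟩
  rw [mem_nbrs] at hv
  exact ⟨v, hv.1, hv.2, fun w hw hLw hne =>
    lt_of_le_of_ne (hmax w (mem_nbrs.2 ⟨hw, hLw⟩)) (fun h => hne (hx h))⟩

/-- On each horizontal side of the leftmost point `L`, at most one point is adjacent both to `L`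
and to the last neighbour of `L`: the neighbours of `L` on one side form a monotone chain. -/
theorem common_nbr_unique (hx : Function.Injective x) (hy : Function.Injective y) {L p q : V}
    (hL : IsLeftmost x S L) (hv : IsLastNbr x y S L v) (hp : p ∈ S) (hq : q ∈ S)
    (hLp : Adj x y S L p) (hLq : Adj x y S L q) (hvp : Adj x y S v p) (hvq : Adj x y S v q)
    (hside : y L < y p ↔ y L < y q) : p = q := by
  by_contra hpq
  wlog hlt : x p < x q generalizing p q
  · exact this hq hp hLq hLp hvq hvp hside.symm (Ne.symm hpq)
      (lt_of_le_of_ne (not_lt.1 hlt) (hx.ne (Ne.symm hpq)))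
  have h₁ := hL.2 p hp hLp.1.symm
  have h₂ := hv.2.2 q hq hLq hvq.1.symm
  have n₁ := hy.ne hLp.1
  have n₂ := hy.ne hLq.1
  have n₃ := hy.ne hpq
  have n₄ := hy.ne hvp.1
  have n₅ := hy.ne hvq.1
  have a₁ := hLq.2 p hp (Or.inl ⟨h₁, hlt⟩)
  have a₂ := hvp.2 q hq (Or.inr ⟨hlt, h₂⟩)
  have a₃ := hv.2.1.2 p hp (Or.inl ⟨h₁, hlt.trans h₂⟩)
  have a₄ := hv.2.1.2 q hq (Or.inl ⟨h₁.trans hlt, h₂⟩)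
  unfold Between at a₁ a₂ a₃ a₄
  omega

theorem card_common_le (hx : Function.Injective x) (hy : Function.Injective y) {L : V}
    (hL : IsLeftmost x S L) (hv : IsLastNbr x y S L v) [DecidableEq V] :
    (nbrs x y S L ∩ nbrs x y S v).card ≤ 2 := by
  classical
  rw [← card_filter_add_card_filter_not (fun p => y L < y p)]
  have h : ∀ (Q : V → Prop) [DecidablePred Q], (∀ p q, Q p → Q q → (y L < y p ↔ y L < y q)) →
      ((nbrs x y S L ∩ nbrs x y S v).filter Q).card ≤ 1 := by
    intro Q _ hQ
    refine card_le_one.2 fun p hp q hq => ?_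
    simp only [mem_filter, mem_inter, mem_nbrs] at hp hq
    exact common_nbr_unique hx hy hL hv hp.1.1.1 hq.1.1.1 hp.1.1.2 hq.1.1.2 hp.1.2.2 hq.1.2.2
      (hQ p q hp.2 hq.2)
  have h₁ := h (fun p => y L < y p) (fun p q hp hq => by tauto)
  have h₂ := h (fun p => ¬ y L < y p) (fun p q hp hq => by tauto)
  omega

theorem card_nbrs_add_le (hx : Function.Injective x) (hy : Function.Injective y) {L : V}
    (hL : IsLeftmost x S L) (hv : IsLastNbr x y S L v) :
    (nbrs x y S L).card + (nbrs x y S v).card ≤ S.card + 2 := by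
  classical
  rw [card_nbrs_add_card_nbrs]
  refine Nat.add_le_add (card_le_card (union_subset ?_ ?_)) (card_common_le hx hy hL hv) <;>
    exact filter_subset _ _

/-- The empty-rectangle graph of `n ≥ 2` points in general position has at most
`⌊n²/4⌋ + n - 2` edges: deleting the leftmost point and its last neighbour costs at most `n + 1`
edges. -/
theorem adjCount_le_edgeBound (hx : Function.Injective x) (hy : Function.Injective y)
    (hS : 2 ≤ S.card) : adjCount x y S S ≤ 2 * edgeBound S.card := by
  classical
  induction hn : S.card using Nat.strong_induction_on generalizing S with
  | _ n ih =>
    rw [hn] at hS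
    by_cases h4 : n < 4
    · have h := adjCount_le_offDiag (x := x) (y := y) (S := S)
      rw [hn] at h
      refine h.trans ?_
      interval_cases n <;> decide
    · obtain ⟨L, hL⟩ := exists_isLeftmost (S := S) hx (card_pos.1 (by omega))
      obtain ⟨v, hv⟩ := exists_isLastNbr (y := y) hx hL (by omega)
      have hdeg := card_nbrs_add_le hx hy hL hv
      have herase := adjCount_erase_erase hL.1 hv.1 hv.2.1
      have hcard : ((S.erase L).erase v).card = n - 2 := by
        rw [card_erase_of_mem (mem_erase.2 ⟨hv.2.1.1.symm, hv.1⟩), card_erase_of_mem hL.1]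
        omega
      have hle := adjCount_le (x := x) (y := y) (S := S) (T := (S.erase L).erase v)
        ((erase_subset _ _).trans (erase_subset _ _))
      have hrec := ih (n - 2) (by omega) (S := (S.erase L).erase v) (by omega) hcard
      have hb := edgeBound_add_two (n := n - 2) (by omega)
      rw [show n - 2 + 2 = n by omega] at hb
      omega

/-! ### Configurations with the largest number of edges -/

/-- The empty-rectangle graph of `S` has the largest possible number of edges. -/
def IsMaximal (x y : V → ℤ) (S : Finset V) : Prop :=
  2 * edgeBound S.card ≤ adjCount x y S S

theorem IsMaximal.swap (h : IsMaximal x y S) : IsMaximal y x S := by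
  rwa [IsMaximal, adjCount_swap]

theorem IsMaximal.neg_right (h : IsMaximal x y S) : IsMaximal x (fun v => -y v) S := by
  rwa [IsMaximal, adjCount_neg_right]

theorem IsMaximal.neg_left (h : IsMaximal x y S) : IsMaximal (fun v => -x v) y S := by
  rwa [IsMaximal, adjCount_neg_left]

theorem IsLastNbr.neg_right {L : V} (h : IsLastNbr x y S L v) :
    IsLastNbr x (fun v => -y v) S L v := by
  simpa only [IsLastNbr, adj_neg_right] using h

theorem injective_neg {f : V → ℤ} (hf : Function.Injective f) :
    Function.Injective fun v => -f v := neg_injective.comp hf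

theorem IsMaximal.card_le_deg_add (h : IsMaximal x y S) (hx : Function.Injective x)
    (hy : Function.Injective y) (hS : 4 ≤ S.card) (hu : u ∈ S) (hv : v ∈ S)
    (huv : Adj x y S u v) : S.card + 2 ≤ (nbrs x y S u).card + (nbrs x y S v).card := by
  classical
  have herase := adjCount_erase_erase hu hv huv
  have hcard : ((S.erase u).erase v).card = S.card - 2 := by
    rw [card_erase_of_mem (mem_erase.2 ⟨huv.1.symm, hv⟩), card_erase_of_mem hu]
    omega
  have hle := adjCount_le (x := x) (y := y) (S := S) (T := (S.erase u).erase v)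
    ((erase_subset _ _).trans (erase_subset _ _))
  have hrec := adjCount_le_edgeBound (S := (S.erase u).erase v) hx hy (by omega)
  rw [hcard] at hrec
  have hb := edgeBound_add_two (n := S.card - 2) (by omega)
  rw [show S.card - 2 + 2 = S.card by omega] at hb
  unfold IsMaximal at h
  omega

open Classical in
theorem IsMaximal.two_le_card_common (h : IsMaximal x y S) (hx : Function.Injective x)
    (hy : Function.Injective y) (hS : 4 ≤ S.card) (hu : u ∈ S) (hv : v ∈ S)
    (huv : Adj x y S u v) : 2 ≤ (nbrs x y S u ∩ nbrs x y S v).card := by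
  have h₁ := h.card_le_deg_add hx hy hS hu hv huv
  rw [card_nbrs_add_card_nbrs] at h₁
  have h₂ : (nbrs x y S u ∪ nbrs x y S v).card ≤ S.card :=
    card_le_card (union_subset (filter_subset _ _) (filter_subset _ _))
  omega

theorem IsMaximal.half_lt_deg (h : IsMaximal x y S) (hx : Function.Injective x)
    (hy : Function.Injective y) (hS : 3 ≤ S.card) (hu : u ∈ S) :
    S.card / 2 < (nbrs x y S u).card := by
  classical
  have herase := adjCount_erase (x := x) (y := y) hu
  have hcard := card_erase_of_mem hu
  have hle := adjCount_le (x := x) (y := y) (erase_subset u S)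
  have hrec := adjCount_le_edgeBound (S := S.erase u) hx hy (by omega)
  rw [hcard] at hrec
  have hb := edgeBound_succ (n := S.card - 1) (by omega)
  rw [show S.card - 1 + 1 = S.card by omega] at hb
  unfold IsMaximal at h
  omega

section LastNbr

variable {L : V} (h : IsMaximal x y S) (hx : Function.Injective x) (hy : Function.Injective y)
  (hS : 4 ≤ S.card) (hL : IsLeftmost x S L) (hv : IsLastNbr x y S L v)

include h hx hy hS hL hv

theorem IsMaximal.adj_or_adj {p : V} (hp : p ∈ S) : Adj x y S L p ∨ Adj x y S v p := by
  classical
  have h₁ := h.card_le_deg_add hx hy hS hL.1 hv.1 hv.2.1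
  rw [card_nbrs_add_card_nbrs] at h₁
  have h₂ := card_common_le hx hy hL hv
  have h₃ : nbrs x y S L ∪ nbrs x y S v = S :=
    eq_of_subset_of_card_le (union_subset (filter_subset _ _) (filter_subset _ _)) (by omega)
  rw [← h₃, mem_union, mem_nbrs, mem_nbrs] at hp
  exact hp.imp And.right And.right

/-- In a maximal configuration the leftmost point and its last neighbour have two common
neighbours, hence one on each side of the leftmost point. -/
theorem IsMaximal.exists_common_above :
    ∃ p ∈ S, Adj x y S L p ∧ Adj x y S v p ∧ y L < y p := by
  classical
  have h₁ := h.two_le_card_common hx hy hS hL.1 hv.1 hv.2.1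
  obtain ⟨p, hp, q, hq, hpq⟩ := one_lt_card.1 h₁
  simp only [mem_inter, mem_nbrs] at hp hq
  by_contra! hc
  have hpL := hc p hp.1.1 hp.1.2 hp.2.2
  have hqL := hc q hq.1.1 hq.1.2 hq.2.2
  exact hpq (common_nbr_unique hx hy hL hv hp.1.1 hq.1.1 hp.1.2 hq.1.2 hp.2.2 hq.2.2
    (by omega))

theorem IsMaximal.exists_common_below :
    ∃ p ∈ S, Adj x y S L p ∧ Adj x y S v p ∧ y p < y L := by
  obtain ⟨p, hp, h₁, h₂, h₃⟩ :=
    h.neg_right.exists_common_above hx (injective_neg hy) hS hL hv.neg_right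
  exact ⟨p, hp, adj_neg_right.1 h₁, adj_neg_right.1 h₂, by omega⟩

theorem IsMaximal.erase_erase [DecidableEq V] : IsMaximal x y ((S.erase L).erase v) ∧
    ∀ a ∈ (S.erase L).erase v, ∀ b ∈ (S.erase L).erase v,
      Adj x y ((S.erase L).erase v) a b → Adj x y S a b := by
  have herase := adjCount_erase_erase hL.1 hv.1 hv.2.1
  have hcard : ((S.erase L).erase v).card = S.card - 2 := by
    rw [card_erase_of_mem (mem_erase.2 ⟨hv.2.1.1.symm, hv.1⟩), card_erase_of_mem hL.1]
    omega
  have hsub : (S.erase L).erase v ⊆ S := (erase_subset _ _).trans (erase_subset _ _)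
  have hle := adjCount_le (x := x) (y := y) hsub
  have hrec := adjCount_le_edgeBound (S := (S.erase L).erase v) hx hy (by omega)
  rw [hcard] at hrec
  have hdeg := card_nbrs_add_le hx hy hL hv
  have hb := edgeBound_add_two (n := S.card - 2) (by omega)
  rw [show S.card - 2 + 2 = S.card by omega] at hb
  unfold IsMaximal at h ⊢
  have herase' : adjCount x y S S + 2 = adjCount x y S ((S.erase L).erase v) +
      2 * ((nbrs x y S L).card + (nbrs x y S v).card) := by convert herase
  refine ⟨by rw [hcard]; omega, fun a ha b hb hab => ?_⟩
  exact adj_of_adjCount_eq hsub (by omega) ha hb hab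

end LastNbr

/-! ### The frame of a maximal configuration -/

/-- A maximal configuration of at least four points whose extreme points `L`, `R`, `T`, `B`
(left, right, top, bottom) satisfy: `L` and `R` are adjacent, and `T` and `B` are adjacent. As the
rectangle of `L` and `R` has full width, their adjacency says that their heights are consecutive;
so the four extreme points divide the other points into four quadrants. -/
structure Frame (x y : V → ℤ) (S : Finset V) (L R T B : V) : Prop where
  inj_x : Function.Injective x
  inj_y : Function.Injective y
  four_le : 4 ≤ S.card
  isMaximal : IsMaximal x y S
  left : IsLeftmost x S L
  right : IsLeftmost (fun v => -x v) S R
  top : IsLeftmost (fun v => -y v) S T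
  bottom : IsLeftmost y S B
  adj_left_right : Adj x y S L R
  adj_top_bottom : Adj x y S T B

namespace Frame

variable {L R T B : V}

theorem flip_x (F : Frame x y S L R T B) : Frame (fun v => -x v) y S R L T B where
  inj_x := injective_neg F.inj_x
  inj_y := F.inj_y
  four_le := F.four_le
  isMaximal := F.isMaximal.neg_left
  left := F.right
  right := by simpa using F.left
  top := F.top
  bottom := F.bottom
  adj_left_right := adj_neg_left.2 F.adj_left_right.symm
  adj_top_bottom := adj_neg_left.2 F.adj_top_bottom

theorem flip_y (F : Frame x y S L R T B) : Frame x (fun v => -y v) S L R B T where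
  inj_x := F.inj_x
  inj_y := injective_neg F.inj_y
  four_le := F.four_le
  isMaximal := F.isMaximal.neg_right
  left := F.left
  right := F.right
  top := by simpa using F.bottom
  bottom := F.top
  adj_left_right := adj_neg_right.2 F.adj_left_right
  adj_top_bottom := adj_neg_right.2 F.adj_top_bottom.symm

theorem transpose (F : Frame x y S L R T B) : Frame y x S B T R L where
  inj_x := F.inj_y
  inj_y := F.inj_x
  four_le := F.four_le
  isMaximal := F.isMaximal.swap
  left := F.bottom
  right := F.top
  top := F.right
  bottom := F.left
  adj_left_right := F.adj_top_bottom.symm.swap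
  adj_top_bottom := F.adj_left_right.symm.swap

variable (F : Frame x y S L R T B)

include F

theorem left_lt {p : V} (hp : p ∈ S) (h : p ≠ L) : x L < x p := F.left.2 p hp h

theorem lt_right {p : V} (hp : p ∈ S) (h : p ≠ R) : x p < x R := by
  have : -x R < -x p := F.right.2 p hp h
  omega

theorem bottom_lt {p : V} (hp : p ∈ S) (h : p ≠ B) : y B < y p := F.bottom.2 p hp h

theorem lt_top {p : V} (hp : p ∈ S) (h : p ≠ T) : y p < y T := by
  have : -y T < -y p := F.top.2 p hp h
  omega

theorem isLastNbr : IsLastNbr x y S L R :=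
  ⟨F.right.1, F.adj_left_right, fun _ hw _ hne => F.lt_right hw hne⟩

theorem adj_left_or_right {p : V} (hp : p ∈ S) : Adj x y S L p ∨ Adj x y S R p :=
  F.isMaximal.adj_or_adj F.inj_x F.inj_y F.four_le F.left F.isLastNbr hp

theorem adj_top_or_bottom {p : V} (hp : p ∈ S) : Adj x y S T p ∨ Adj x y S B p :=
  (F.transpose.adj_left_or_right hp).symm.imp Adj.swap Adj.swap

theorem above_or_below {p : V} (hp : p ∈ S) (hL : p ≠ L) (hR : p ≠ R) :
    (y L < y p ∧ y R < y p) ∨ (y p < y L ∧ y p < y R) := by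
  have h₁ := F.adj_left_right.2 p hp (Or.inl ⟨F.left_lt hp hL, F.lt_right hp hR⟩)
  have h₂ := F.inj_y.ne hL
  have h₃ := F.inj_y.ne hR
  unfold Between at h₁
  omega

theorem left_or_right {p : V} (hp : p ∈ S) (hT : p ≠ T) (hB : p ≠ B) :
    (x p < x T ∧ x p < x B) ∨ (x T < x p ∧ x B < x p) := by
  have := F.transpose.above_or_below hp hB hT
  omega

/-- The tip above the line through `L` and `R`: a point adjacent to both of them. -/
theorem exists_tip : ∃ z ∈ S, Adj x y S L z ∧ Adj x y S R z ∧ y L < y z ∧ y R < y z := by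
  obtain ⟨z, hz, h₁, h₂, h₃⟩ :=
    F.isMaximal.exists_common_above F.inj_x F.inj_y F.four_le F.left F.isLastNbr
  have := F.above_or_below hz h₁.1.symm h₂.1.symm
  exact ⟨z, hz, h₁, h₂, h₃, by omega⟩

theorem top_above : y L < y T ∧ y R < y T := by
  obtain ⟨z, hz, -, -, h₁, h₂⟩ := F.exists_tip
  by_cases h : z = T
  · exact h ▸ ⟨h₁, h₂⟩
  · have := F.lt_top hz h
    omega

theorem bottom_below : y B < y L ∧ y B < y R := by
  have := F.flip_y.top_above
  omega

theorem left_left : x L < x T ∧ x L < x B := by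
  have := F.transpose.bottom_below
  omega

theorem right_right : x T < x R ∧ x B < x R := by
  have := F.transpose.top_above
  omega

/-- A point of the upper left quadrant separates `L` from `T`. -/
theorem not_adj_left_top {p : V} (hp : p ∈ S) (h₁ : x p < x T) (h₂ : y L < y p) :
    ¬ Adj x y S L T := by
  have h₃ := F.lt_top hp (fun h => by subst h; omega)
  have h₄ := F.left_lt hp (fun h => by subst h; omega)
  exact not_adj_of_between hp (Or.inl ⟨h₄, h₁⟩) (Or.inl ⟨h₂, h₃⟩)

/-- The upper left and the lower left quadrant are not both inhabited, since `L` is adjacent to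
`T` or to `B`. -/
theorem not_upper_left_lower_left {p q : V} (hp : p ∈ S) (h₁ : x p < x T) (h₂ : y L < y p)
    (hq : q ∈ S) (h₃ : x q < x B) (h₄ : y q < y L) : False := by
  rcases F.adj_top_or_bottom F.left.1 with h | h
  · exact F.not_adj_left_top hp h₁ h₂ h.symm
  · exact F.flip_y.not_adj_left_top hq h₃ (by omega) (adj_neg_right.2 h.symm)

theorem not_upper_left_upper_right {p q : V} (hp : p ∈ S) (h₁ : x p < x T) (h₂ : y L < y p)
    (hq : q ∈ S) (h₃ : x T < x q) (h₄ : y R < y q) : False := by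
  rcases F.adj_left_or_right F.top.1 with h | h
  · exact F.not_adj_left_top hp h₁ h₂ h
  · exact F.flip_x.not_adj_left_top hq (by omega) h₄ (adj_neg_left.2 h)

/-- The points of the upper left quadrant form an increasing chain. Otherwise let `p` be the
leftmost point with another point `q` to its lower right. Then `p` is adjacent neither to `R` nor
to `B`, so that the two common neighbours of `L` and `p` lie in the same quadrant. Neighbours of
`L` there form a decreasing chain; by the choice of `p`, both common neighbours come after `p` in
it, and the nearer one separates `p` from the other one. -/
theorem upper_left_chain {p q : V} (hp : p ∈ S) (hpT : x p < x T) (hpB : x p < x B)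
    (hpL : y L < y p) (hpR : y R < y p) (hq : q ∈ S) (hqT : x q < x T) (hqB : x q < x B)
    (hqL : y L < y q) (hqR : y R < y q) (hpq : x p < x q) : y p < y q := by
  classical
  by_contra hlt
  let bad : Finset V := S.filter fun p => x p < x T ∧ x p < x B ∧ y L < y p ∧ y R < y p ∧
    ∃ q ∈ S, x q < x T ∧ x q < x B ∧ y L < y q ∧ y R < y q ∧ x p < x q ∧ y q < y p
  have hne : bad.Nonempty := by
    refine ⟨p, mem_filter.2 ⟨hp, hpT, hpB, hpL, hpR, q, hq, hqT, hqB, hqL, hqR, hpq, ?_⟩⟩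
    exact lt_of_le_of_ne (not_lt.1 hlt) (F.inj_y.ne (fun h => by subst h; omega))
  clear! p q
  obtain ⟨p, hpbad, hmin⟩ := exists_min_image bad x hne
  obtain ⟨hp, hpT, hpB, hpL, hpR, q, hq, hqT, hqB, hqL, hqR, hpq, hqp⟩ := mem_filter.1 hpbad
  have hR := F.right_right
  have hB := F.bottom_below
  have hnR : ¬ Adj x y S R p :=
    not_adj_of_between hq (Or.inr ⟨hpq, by omega⟩) (Or.inl ⟨hqR, hqp⟩)
  have hnB : ¬ Adj x y S B p :=
    not_adj_of_between hq (Or.inr ⟨hpq, by omega⟩) (Or.inl ⟨by omega, hqp⟩)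
  have hLp : Adj x y S L p := (F.adj_left_or_right hp).resolve_right hnR
  -- every common neighbour of `L` and `p` lies in the upper left quadrant
  have hquad : ∀ c ∈ S, Adj x y S L c → Adj x y S p c →
      x c < x T ∧ x c < x B ∧ y L < y c ∧ y R < y c := by
    intro c hc hLc hpc
    have hcR : c ≠ R := fun h => hnR (h ▸ hpc.symm)
    have hcB : c ≠ B := fun h => hnB (h ▸ hpc.symm)
    have hcT : c ≠ T := fun h => F.not_adj_left_top hp hpT hpL (h ▸ hLc)
    have hv := F.above_or_below hc hLc.1.symm hcR
    have hh := F.left_or_right hc hcT hcB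
    rcases hv with hv | hv <;> rcases hh with hh | hh
    · exact ⟨hh.1, hh.2, hv⟩
    · exact (F.not_upper_left_upper_right hp hpT hpL hc hh.1 hv.2).elim
    · exact (F.not_upper_left_lower_left hp hpT hpL hc hh.2 hv.1).elim
    · exact absurd hpc (not_adj_of_between hq (Or.inl ⟨hpq, by omega⟩) (Or.inr ⟨by omega, hqp⟩))
  have hafter : ∀ c ∈ S, Adj x y S L c → Adj x y S p c → x p < x c ∧ y c < y p := by
    intro c hc hLc hpc
    obtain ⟨h₁, h₂, h₃, h₄⟩ := hquad c hc hLc hpc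
    have hxL := F.left_lt hc hLc.1.symm
    have hxp := F.left_lt hp hLp.1.symm
    have hxne := F.inj_x.ne hpc.1
    have hyne := F.inj_y.ne hpc.1
    have hb₁ := hLp.2 c hc
    have hb₂ := hLc.2 p hp
    unfold Between at hb₁ hb₂
    rcases lt_or_gt_of_ne hxne with hlt | hlt
    · exact ⟨hlt, by omega⟩
    · have := hmin c (mem_filter.2
        ⟨hc, h₁, h₂, h₃, h₄, p, hp, hpT, hpB, hpL, hpR, hlt, by omega⟩)
      omega
  have h₁ := F.isMaximal.two_le_card_common F.inj_x F.inj_y F.four_le F.left.1 hp hLp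
  obtain ⟨c, hc, d, hd, hcd⟩ := one_lt_card.1 h₁
  simp only [mem_inter, mem_nbrs] at hc hd
  wlog hxcd : x c < x d generalizing c d
  · exact this d c (Ne.symm hcd) hd hc
      (lt_of_le_of_ne (not_lt.1 hxcd) (F.inj_x.ne (Ne.symm hcd)))
  have hc' := hafter c hc.1.1 hc.1.2 hc.2.2
  have hd' := hafter d hd.1.1 hd.1.2 hd.2.2
  have hqc := hquad c hc.1.1 hc.1.2 hc.2.2
  have hb₁ := hd.2.2.2 c hc.1.1
  have hb₂ := hd.1.2.2 c hc.1.1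
  have hxL := F.left_lt hc.1.1 hc.1.2.1.symm
  have hyne := F.inj_y.ne hcd
  unfold Between at hb₁ hb₂
  omega

/-- A point of the upper left quadrant is adjacent to `R`. -/
theorem adj_right_of_upper_left {p : V} (hp : p ∈ S) (hpT : x p < x T) (hpB : x p < x B)
    (hpL : y L < y p) (hpR : y R < y p) : Adj x y S R p := by
  by_contra hn
  obtain ⟨q, hq, h₁, h₂⟩ := exists_between_of_not_adj (fun h => by subst h; omega) hn
  have hR := F.right_right
  have hB := F.bottom_below
  have hx : x p < x q ∧ x q < x R := by unfold Between at h₁; omega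
  have hy : y R < y q ∧ y q < y p := by unfold Between at h₂; omega
  have hpl := F.left_lt hp (fun h => by subst h; omega)
  have hpt := F.lt_top hp (fun h => by subst h; omega)
  have hv := F.above_or_below hq (fun h => by subst h; omega) (fun h => by subst h; omega)
  have hh := F.left_or_right hq (fun h => by subst h; omega) (fun h => by subst h; omega)
  rcases hh with hh | hh
  · have := F.upper_left_chain hp hpT hpB hpL hpR hq hh.1 hh.2 (by omega) hy.1 hx.1
    omega
  · exact F.not_upper_left_upper_right hp hpT hpL hq hh.1 hy.1

end Frame

/-! ### Adjacency of opposite extreme points -/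

theorem IsMaximal.adj_of_card_le_three (h : IsMaximal x y S) (h₂ : 2 ≤ S.card) (h₃ : S.card ≤ 3)
    (hu : u ∈ S) (hv : v ∈ S) (huv : u ≠ v) : Adj x y S u v := by
  refine adj_of_offDiag_le (le_trans ?_ h) hu hv huv
  generalize S.card = n at h₂ h₃
  interval_cases n <;> decide

/-- In a maximal configuration, the leftmost and the rightmost point are adjacent. Otherwise the
last neighbour `v` of the leftmost point `L` differs from the rightmost point `R`. Deleting `L` and
`v` leaves a maximal configuration in which the claim holds, horizontally and vertically, and whose
edges have no rectangle that contains `v`. This confines `v` to one quadrant of the frame of the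
smaller configuration, and every position of `v` there is contradictory. -/
theorem IsMaximal.adj_left_right (h : IsMaximal x y S) (hx : Function.Injective x)
    (hy : Function.Injective y) (hS : 2 ≤ S.card) {L R : V} (hL : IsLeftmost x S L)
    (hR : IsLeftmost (fun v => -x v) S R) : Adj x y S L R := by
  classical
  induction hn : S.card using Nat.strong_induction_on generalizing S x y L R with
  | _ n ih =>
  have hRmax : ∀ w ∈ S, w ≠ R → x w < x R := fun w hw hne => by
    have : -x R < -x w := hR.2 w hw hne
    omega
  have hLR : L ≠ R := by
    rintro rfl
    obtain ⟨a, ha, hne⟩ := exists_mem_ne (by omega : 1 < S.card) L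
    have h₁ := hRmax a ha hne
    have h₂ := hL.2 a ha hne
    omega
  rcases Nat.lt_or_ge S.card 4 with h4 | h4
  · exact h.adj_of_card_le_three hS (by omega) hL.1 hR.1 hLR
  by_contra hnLR
  obtain ⟨v, hv⟩ := exists_isLastNbr (y := y) hx hL hS
  have hvR : v ≠ R := fun h => hnLR (h ▸ hv.2.1)
  wlog hyRv : y R < y v generalizing y
  · refine this h.neg_right (injective_neg hy) (fun h => hnLR (adj_neg_right.1 h)) hv.neg_right ?_
    have := hy.ne hvR
    omega
  obtain ⟨w, hw, hLw, hvw, hyw⟩ := h.exists_common_above hx hy h4 hL hv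
  obtain ⟨w', hw', hLw', hvw', hyw'⟩ := h.exists_common_below hx hy h4 hL hv
  obtain ⟨hmax, hkeep⟩ := h.erase_erase hx hy h4 hL hv
  have hcover : ∀ {p}, p ∈ S → Adj x y S L p ∨ Adj x y S v p :=
    fun hp => h.adj_or_adj hx hy h4 hL hv hp
  have hsub : ∀ {p}, p ∈ (S.erase L).erase v → p ∈ S ∧ p ≠ L ∧ p ≠ v := fun hp => by
    simp only [mem_erase] at hp
    exact ⟨hp.2.2, hp.2.1, hp.1⟩
  have hmem : ∀ {p}, p ∈ S → p ≠ L → p ≠ v → p ∈ (S.erase L).erase v := fun hp h₁ h₂ =>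
    mem_erase.2 ⟨h₂, mem_erase.2 ⟨h₁, hp⟩⟩
  have hcard : ((S.erase L).erase v).card = S.card - 2 := by
    rw [card_erase_of_mem (mem_erase.2 ⟨hv.2.1.1.symm, hv.1⟩), card_erase_of_mem hL.1]
    omega
  generalize (S.erase L).erase v = S' at hmax hkeep hsub hmem hcard
  have hxLv := hL.2 v hv.1 hv.2.1.1.symm
  have hxvR := hRmax v hv.1 hvR
  have hxLw := hL.2 w hw hLw.1.symm
  have hxLw' := hL.2 w' hw' hLw'.1.symm
  have hxwv := hv.2.2 w hw hLw hvw.1.symm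
  have hxwv' := hv.2.2 w' hw' hLw' hvw'.1.symm
  have hyvw : y v < y w := by
    have := hv.2.1.2 w hw (Or.inl ⟨hxLw, hxwv⟩)
    have := hy.ne hvw.1
    unfold Between at *
    omega
  have hyvw' : y w' < y v := by
    have := hv.2.1.2 w' hw' (Or.inl ⟨hxLw', hxwv'⟩)
    have := hy.ne hvw'.1
    unfold Between at *
    omega
  have hwS := hmem hw hLw.1.symm hvw.1.symm
  have hwS' := hmem hw' hLw'.1.symm hvw'.1.symm
  have hRS := hmem hR.1 hLR.symm hvR.symm
  -- `v` lies in the rectangle of `w` and `R`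
  have hnwR : ¬ Adj x y S' R w := fun hadj =>
    not_adj_of_between hv.1 (Or.inr ⟨hxwv, hxvR⟩) (Or.inl ⟨hyRv, hyvw⟩) (hkeep _ hRS _ hwS hadj)
  rcases Nat.lt_or_ge S'.card 4 with h4' | h4'
  · exact hnwR (hmax.adj_of_card_le_three (by omega) (by omega) hRS hwS
      (fun h => by subst h; omega))
  have hne : S'.Nonempty := ⟨w, hwS⟩
  obtain ⟨L', hL'⟩ := exists_isLeftmost hx hne
  obtain ⟨B', hB'⟩ := exists_isLeftmost hy hne
  obtain ⟨T', hT'⟩ := exists_isLeftmost (injective_neg hy) hne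
  have hR' : IsLeftmost (fun v => -x v) S' R := ⟨hRS, fun a ha => hR.2 a (hsub ha).1⟩
  have F : Frame x y S' L' R T' B' :=
    { inj_x := hx
      inj_y := hy
      four_le := h4'
      isMaximal := hmax
      left := hL'
      right := hR'
      top := hT'
      bottom := hB'
      adj_left_right := ih S'.card (by omega) hmax hx hy (by omega) hL' hR' rfl
      adj_top_bottom := (ih S'.card (by omega) hmax.swap hy hx (by omega) hB' hT' rfl).symm.swap }
  have hadjLR := hkeep _ hL'.1 _ hRS F.adj_left_right
  have hadjTB := hkeep _ hT'.1 _ hB'.1 F.adj_top_bottom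
  have hxL'v : x L' < x v := by
    by_cases h : w = L'
    · rwa [← h]
    · exact (F.left_lt hwS h).trans hxwv
  have hyvT' : y v < y T' := by
    by_cases h : w = T'
    · rwa [← h]
    · exact hyvw.trans (F.lt_top hwS h)
  have hyB'v : y B' < y v := by
    by_cases h : w' = B'
    · rwa [← h]
    · exact (F.bottom_lt hwS' h).trans hyvw'
  have hyL'v : y L' < y v := by
    have h₁ := hadjLR.2 v hv.1 (Or.inl ⟨hxL'v, hxvR⟩)
    have h₂ := hy.ne (hsub hL'.1).2.2
    unfold Between at h₁
    omega
  have hside : (x v < x T' ∧ x v < x B') ∨ (x T' < x v ∧ x B' < x v) := by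
    have h₁ := hadjTB.2 v hv.1
    have h₂ := hx.ne (hsub hT'.1).2.2
    have h₃ := hx.ne (hsub hB'.1).2.2
    unfold Between at h₁
    omega
  rcases hside with hside | hside
  · exact hnwR (F.adj_right_of_upper_left hwS (by omega) (by omega) (by omega) (by omega))
  have hRR := F.right_right
  have hBB := F.bottom_below
  have hTT := F.top_above
  have hLL := F.left_left
  have hnTR : ¬ Adj x y S' T' R := fun hadj =>
    not_adj_of_between hv.1 (Or.inl ⟨hside.1, hxvR⟩) (Or.inr ⟨hyRv, hyvT'⟩)
      (hkeep _ hT'.1 _ hRS hadj)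
  -- the upper right quadrant is inhabited, so the tip above `L'` and `R` lies in it
  obtain ⟨q, hq, hxq, hyq⟩ := exists_between_of_not_adj (fun h => by subst h; omega) hnTR
  have hxq' : x T' < x q := by unfold Between at hxq; omega
  have hyq' : y R < y q := by unfold Between at hyq; omega
  obtain ⟨z, hz, hLz, hRz, hyLz, hyRz⟩ := F.exists_tip
  have hzT : z ≠ T' := fun h => hnTR (h ▸ hRz.symm)
  have hzB : z ≠ B' := fun h => by subst h; omega
  have hxz : x T' < x z ∧ x B' < x z := (F.left_or_right hz hzT hzB).resolve_left fun hl =>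
    F.not_upper_left_upper_right hz hl.1 hyLz hq hxq' hyq'
  have hzR := F.lt_right hz hRz.1.symm
  have hzv := hx.ne (hsub hz).2.2
  rcases lt_or_gt_of_ne hzv with hlt | hlt
  · -- `z` separates `B'` from `v`, and `L'` separates it from `L`
    have h₁ := (hkeep _ hRS _ hz hRz).2 v hv.1 (Or.inr ⟨hlt, hxvR⟩)
    have hyzv : y z < y v := by
      have := hy.ne (hsub hz).2.2
      unfold Between at h₁
      omega
    have hxLL' := hL.2 L' (hsub hL'.1).1 (hsub hL'.1).2.1
    have hyL'L : y L' < y L := by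
      have h₂ := hv.2.1.2 L' (hsub hL'.1).1 (Or.inl ⟨hxLL', hxL'v⟩)
      have := hy.ne (hsub hL'.1).2.1
      unfold Between at h₂
      omega
    rcases hcover (hsub hB'.1).1 with hadj | hadj
    · exact not_adj_of_between (hsub hL'.1).1 (Or.inl ⟨hxLL', hLL.2⟩)
        (Or.inr ⟨hBB.1, hyL'L⟩) hadj
    · exact not_adj_of_between (hsub hz).1 (Or.inr ⟨hxz.2, hlt⟩)
        (Or.inr ⟨by omega, hyzv⟩) hadj
  · -- `z` separates `R` from `v`
    have h₁ := (hkeep _ hL'.1 _ hz hLz).2 v hv.1 (Or.inl ⟨hxL'v, hlt⟩)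
    have hyzv : y z < y v := by
      have := hy.ne (hsub hz).2.2
      unfold Between at h₁
      omega
    refine (hcover hR.1).elim hnLR fun hadj => ?_
    exact not_adj_of_between (hsub hz).1 (Or.inl ⟨hlt, hzR⟩) (Or.inr ⟨hyRz, hyzv⟩) hadj

end Graph

section Bruhat

variable {n : ℕ} {σ π : Perm (Fin n)} {i j : Fin n}

/-! ### Length and inversions -/

/-- The number of inversions of a permutation. -/
def invCount (π : Perm (Fin n)) : ℕ :=
  ∑ k, ∑ l, if k < l ∧ π l < π k then 1 else 0

theorem two_mul_invCount (π : Perm (Fin n)) : 2 * invCount π =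
    ∑ k, ∑ l, if (k < l ∧ π l < π k) ∨ (l < k ∧ π k < π l) then 1 else 0 := by
  have h : invCount π = ∑ k, ∑ l, if l < k ∧ π k < π l then 1 else 0 := by
    rw [invCount, sum_comm]
  rw [two_mul]
  nth_rewrite 2 [h]
  rw [invCount, ← sum_add_distrib]
  refine sum_congr rfl fun k _ => ?_
  rw [← sum_add_distrib]
  refine sum_congr rfl fun l _ => ?_
  split_ifs <;> first | rfl | omega

theorem sum_sum_eq_of_symm {ι : Type*} [Fintype ι] [DecidableEq ι] (g : ι → ι → ℕ)
    (hs : ∀ a b, g a b = g b a) (h0 : ∀ a, g a a = 0) {i j : ι} (hij : i ≠ j) :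
    ∑ a, ∑ b, g a b = ∑ a ∈ (univ.erase i).erase j, ∑ b ∈ (univ.erase i).erase j, g a b +
      2 * ∑ a ∈ (univ.erase i).erase j, (g i a + g j a) + 2 * g i j := by
  have hj : j ∈ univ.erase i := mem_erase.2 ⟨hij.symm, mem_univ j⟩
  have hsum : ∀ f : ι → ℕ, ∑ a, f a = f i + (f j + ∑ a ∈ (univ.erase i).erase j, f a) :=
    fun f => by rw [add_sum_erase _ f hj, add_sum_erase _ f (mem_univ i)]
  have e₁ : ∑ b, g i b = g i j + ∑ a ∈ (univ.erase i).erase j, g i a := by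
    rw [hsum, h0, zero_add]
  have e₂ : ∑ b, g j b = g i j + ∑ a ∈ (univ.erase i).erase j, g j a := by
    rw [hsum, h0, zero_add, hs j i]
  have e₃ : ∑ a ∈ (univ.erase i).erase j, ∑ b, g a b =
      ∑ a ∈ (univ.erase i).erase j, (g i a + (g j a +
        ∑ b ∈ (univ.erase i).erase j, g a b)) :=
    sum_congr rfl fun a _ => by rw [hsum, hs a i, hs a j]
  rw [hsum (fun a => ∑ b, g a b), e₁, e₂, e₃]
  simp only [sum_add_distrib]
  omega

/-- If `(i, j)` is not an inversion of `σ` and the rectangle of its two points is empty, then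
interchanging the values at `i` and `j` creates exactly one inversion. -/
theorem invCount_mul_swap (hij : i < j) (hσ : σ i < σ j)
    (he : ∀ k, i < k → k < j → ¬ (σ i < σ k ∧ σ k < σ j)) :
    invCount (σ * swap i j) = invCount σ + 1 := by
  have h₁ := two_mul_invCount σ
  have h₂ := two_mul_invCount (σ * swap i j)
  have hi : (σ * swap i j) i = σ j := by simp
  have hj : (σ * swap i j) j = σ i := by simp
  have hk : ∀ k, k ≠ i → k ≠ j → (σ * swap i j) k = σ k := fun k h h' => by
    simp [swap_apply_of_ne_of_ne h h']
  rw [sum_sum_eq_of_symm _ (fun a b => by simp only [or_comm]) (fun a => by simp) hij.ne]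
    at h₁ h₂
  have e₁ : ∑ a ∈ (univ.erase i).erase j, ∑ b ∈ (univ.erase i).erase j,
        (if (a < b ∧ (σ * swap i j) b < (σ * swap i j) a) ∨
          (b < a ∧ (σ * swap i j) a < (σ * swap i j) b) then 1 else 0) =
      ∑ a ∈ (univ.erase i).erase j, ∑ b ∈ (univ.erase i).erase j,
        (if (a < b ∧ σ b < σ a) ∨ (b < a ∧ σ a < σ b) then 1 else 0) := by
    refine sum_congr rfl fun a ha => sum_congr rfl fun b hb => ?_
    simp only [mem_erase, mem_univ, and_true] at ha hb
    rw [hk a ha.2 ha.1, hk b hb.2 hb.1]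
  have e₂ : ∑ a ∈ (univ.erase i).erase j,
        ((if (i < a ∧ (σ * swap i j) a < (σ * swap i j) i) ∨
          (a < i ∧ (σ * swap i j) i < (σ * swap i j) a) then 1 else 0) +
        (if (j < a ∧ (σ * swap i j) a < (σ * swap i j) j) ∨
          (a < j ∧ (σ * swap i j) j < (σ * swap i j) a) then 1 else 0)) =
      ∑ a ∈ (univ.erase i).erase j,
        ((if (i < a ∧ σ a < σ i) ∨ (a < i ∧ σ i < σ a) then 1 else 0) +
        (if (j < a ∧ σ a < σ j) ∨ (a < j ∧ σ j < σ a) then 1 else 0)) := by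
    refine sum_congr rfl fun a ha => ?_
    simp only [mem_erase, mem_univ, and_true] at ha
    rw [hk a ha.2 ha.1, hi, hj]
    have n₁ := σ.injective.ne ha.1
    have n₂ := σ.injective.ne ha.2
    have := he a
    split_ifs <;> omega
  have e₃ : (if (i < j ∧ (σ * swap i j) j < (σ * swap i j) i) ∨
      (j < i ∧ (σ * swap i j) i < (σ * swap i j) j) then 1 else 0) = 1 := by
    rw [hi, hj, if_pos (Or.inl ⟨hij, hσ⟩)]
  have e₄ : (if (i < j ∧ σ j < σ i) ∨ (j < i ∧ σ i < σ j) then 1 else 0) = 0 :=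
    if_neg (by omega)
  rw [e₁, e₂, e₃] at h₂
  rw [e₄] at h₁
  omega

theorem swap_mul_swap_mul_swap_eq {k : Fin n} (hij : i ≠ j) (hkj : k ≠ j) (hik : i ≠ k) :
    swap i k * swap i j * swap k j = swap i j := by
  ext a
  simp only [Perm.mul_apply, swap_apply_def]
  split_ifs <;> simp_all

/-- Removing a non-inversion strictly increases the number of inversions, whether or not the
rectangle is empty: a point `k` in the rectangle splits the transposition into three such steps,
and if `k` is the highest such point, the middle one has an empty rectangle. -/
theorem invCount_lt_mul_swap (hij : i < j) (hσ : σ i < σ j) :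
    invCount σ < invCount (σ * swap i j) := by
  induction hd : (j : ℕ) - i using Nat.strong_induction_on generalizing σ i j with
  | _ d ih =>
  by_cases he : ∀ k, i < k → k < j → ¬ (σ i < σ k ∧ σ k < σ j)
  · rw [invCount_mul_swap hij hσ he]
    omega
  · push Not at he
    obtain ⟨k₀, h₀⟩ := he
    obtain ⟨k, hk, hmax⟩ := exists_max_image
      (univ.filter fun k => i < k ∧ k < j ∧ σ i < σ k ∧ σ k < σ j) σ
      ⟨k₀, mem_filter.2 ⟨mem_univ _, h₀.1, h₀.2.1, h₀.2.2⟩⟩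
    simp only [mem_filter, mem_univ, true_and] at hk hmax
    obtain ⟨hik, hkj, hσk, hσk'⟩ := hk
    have s₁ := ih (k - i) (by omega) hik hσk rfl
    have h₁i : (σ * swap i k) i = σ k := by simp
    have h₁k : (σ * swap i k) k = σ i := by simp
    have h₁ : ∀ l, l ≠ i → l ≠ k → (σ * swap i k) l = σ l := fun l h h' => by
      simp [swap_apply_of_ne_of_ne h h']
    have h₁j := h₁ j hij.ne' hkj.ne'
    generalize hτ : σ * swap i k = τ at s₁ h₁i h₁k h₁ h₁j
    have s₂ := invCount_mul_swap (σ := τ) hij (by rw [h₁i, h₁j]; exact hσk') (by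
      intro l hl hl' hc
      by_cases hlk : l = k
      · subst hlk
        omega
      · rw [h₁ l hl.ne' hlk, h₁i, h₁j] at hc
        have := hmax l ⟨hl, hl', by omega, hc.2⟩
        omega)
    have h₂k : (τ * swap i j) k = σ i := by
      simp [swap_apply_of_ne_of_ne hik.ne' hkj.ne, h₁k]
    have h₂j : (τ * swap i j) j = σ k := by simp [h₁i]
    have s₃ := ih (j - k) (by omega) (σ := τ * swap i j) hkj (by rw [h₂k, h₂j]; exact hσk) rfl
    rw [← hτ, mul_assoc, mul_assoc, swap_mul_swap_mul_swap_eq hij.ne hkj.ne hik.ne, ← mul_assoc,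
      hτ] at s₃
    omega

theorem invCount_mul_simple_le {s : Perm (Fin n)} (hs : IsSimple s) (σ : Perm (Fin n)) :
    invCount (σ * s) ≤ invCount σ + 1 := by
  obtain ⟨i, j, hij, rfl⟩ := hs
  have hlt : i < j := by rw [Fin.lt_def]; omega
  rcases lt_or_gt_of_ne (σ.injective.ne hlt.ne) with h | h
  · exact (invCount_mul_swap hlt h fun k h₁ h₂ => by omega).le
  · have := invCount_lt_mul_swap (σ := σ * swap i j) hlt (by simpa using h)
    rw [mul_assoc, swap_mul_self, mul_one] at this
    omega

theorem invCount_prod_le (w : List (Perm (Fin n))) (hw : ∀ s ∈ w, IsSimple s) :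
    invCount w.prod ≤ w.length := by
  induction w using List.reverseRecOn with
  | nil =>
    have : ∀ k l : Fin n, ¬ (k < l ∧ l < k) := fun k l h => by omega
    simp [invCount, this]
  | append_singleton w s ih =>
    have h₁ := ih fun t ht => hw t (by simp [ht])
    have h₂ := invCount_mul_simple_le (hw s (by simp)) w.prod
    simp only [List.prod_append, List.prod_singleton, List.length_append, List.length_singleton]
    omega

theorem eq_one_of_strictMono (h : StrictMono π) : π = 1 := by
  have : (⟨π, by intro a b; exact h.le_iff_le⟩ : Fin n ≃o Fin n) = OrderIso.refl _ :=
    Subsingleton.elim _ _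
  ext i
  exact congrArg Fin.val (DFunLike.congr_fun this i)

theorem exists_word (π : Perm (Fin n)) : ∃ w : List (Perm (Fin n)),
    (∀ s ∈ w, IsSimple s) ∧ w.prod = π ∧ w.length = invCount π := by
  induction hd : invCount π using Nat.strong_induction_on generalizing π with
  | _ d ih =>
  by_cases h : ∃ i j : Fin n, (j : ℕ) = i + 1 ∧ π j < π i
  · obtain ⟨i, j, hij, hlt⟩ := h
    have h₁ := invCount_mul_swap (σ := π * swap i j) (i := i) (j := j)
      (by rw [Fin.lt_def]; omega) (by simpa using hlt) (fun k h₁ h₂ => by omega)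
    rw [mul_assoc, swap_mul_self, mul_one] at h₁
    obtain ⟨w, hw, hprod, hlen⟩ := ih _ (by omega) (π * swap i j) rfl
    refine ⟨w ++ [swap i j], fun s hs => ?_, ?_, ?_⟩
    · rcases List.mem_append.1 hs with hs | hs
      · exact hw s hs
      · rw [List.mem_singleton.1 hs]
        exact ⟨i, j, hij, rfl⟩
    · rw [List.prod_append, hprod, List.prod_singleton, mul_assoc, swap_mul_self, mul_one]
    · rw [List.length_append, hlen, List.length_singleton]
      omega
  · push Not at h
    have hmono : π = 1 := by
      apply eq_one_of_strictMono
      cases n with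
      | zero => exact fun a => a.elim0
      | succ m =>
        refine Fin.strictMono_iff_lt_succ.2 fun i => lt_of_le_of_ne (h _ _ (by simp)) ?_
        exact π.injective.ne (Fin.castSucc_lt_succ).ne
    have : ∀ k l : Fin n, ¬ (k < l ∧ l < k) := fun k l h => by omega
    refine ⟨[], by simp, by simp [hmono], ?_⟩
    rw [← hd, hmono]
    simp [invCount, this]

theorem length_eq_invCount (π : Perm (Fin n)) : length π = invCount π := by
  refine le_antisymm (Nat.sInf_le (exists_word π)) ?_
  refine le_csInf ⟨_, exists_word π⟩ ?_
  rintro k ⟨w, hw, rfl, rfl⟩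
  exact invCount_prod_le w hw

/-! ### The covering relation -/

theorem step_iff : Step σ π ↔ ∃ i j, i < j ∧ σ i < σ j ∧ π = σ * swap i j := by
  constructor
  · rintro ⟨t, ⟨a, b, hab, rfl⟩, rfl, hlt⟩
    rw [swap_mul_eq_mul_swap] at hlt ⊢
    have hne : σ⁻¹ a ≠ σ⁻¹ b := σ⁻¹.injective.ne hab
    generalize σ⁻¹ a = i at hlt hne
    generalize σ⁻¹ b = j at hlt hne
    rw [length_eq_invCount, length_eq_invCount] at hlt
    have key : ∀ i j : Fin n, i < j → invCount σ < invCount (σ * swap i j) →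
        σ i < σ j := by
      intro i j hij hlt
      by_contra hc
      have h := invCount_lt_mul_swap (σ := σ * swap i j) hij (by
        simpa using lt_of_le_of_ne (not_lt.1 hc) (σ.injective.ne hij.ne'))
      rw [mul_assoc, swap_mul_self, mul_one] at h
      omega
    rcases lt_or_gt_of_ne hne with h | h
    · exact ⟨i, j, h, key i j h hlt, rfl⟩
    · exact ⟨j, i, h, key j i h (by rwa [swap_comm]), by rw [swap_comm]⟩
  · rintro ⟨i, j, hij, hσ, rfl⟩
    refine ⟨swap (σ i) (σ j), ⟨_, _, hσ.ne, rfl⟩, ?_, ?_⟩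
    · rw [mul_swap_eq_swap_mul]
    · rw [length_eq_invCount, length_eq_invCount]
      exact invCount_lt_mul_swap hij hσ

theorem length_lt_of_lt (h : σ < π) : length σ < length π :=
  (eq_or_length_lt h.le).resolve_left h.ne

theorem lt_mul_swap (hij : i < j) (hσ : σ i < σ j) : σ < σ * swap i j := by
  refine lt_of_le_of_ne (Relation.ReflTransGen.single (step_iff.2 ⟨i, j, hij, hσ, rfl⟩)) ?_
  intro h
  have := invCount_lt_mul_swap hij hσ
  rw [← h] at this
  omega

/-- The covering relation of the strong Bruhat order: `π` covers `σ` if and only if it arises by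
interchanging two values of `σ` in increasing order that span an empty rectangle. -/
theorem covBy_iff : σ ⋖ π ↔ ∃ i j, i < j ∧ σ i < σ j ∧
    (∀ k, i < k → k < j → ¬ (σ i < σ k ∧ σ k < σ j)) ∧ π = σ * swap i j := by
  constructor
  · intro h
    rcases Relation.ReflTransGen.cases_head h.le with heq | ⟨c, hc, hcπ⟩
    · exact absurd heq h.lt.ne
    obtain ⟨i, j, hij, hσ, rfl⟩ := step_iff.1 hc
    have hle : σ * swap i j ≤ π := hcπ
    obtain rfl : σ * swap i j = π := by
      by_contra hne
      exact h.2 (lt_mul_swap hij hσ) (lt_of_le_of_ne hle hne)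
    refine ⟨i, j, hij, hσ, fun k hik hkj hk => ?_, rfl⟩
    have h₁i : (σ * swap i k) i = σ k := by simp
    have h₁k : (σ * swap i k) k = σ i := by simp
    have h₁j : (σ * swap i k) j = σ j := by
      simp [swap_apply_of_ne_of_ne hij.ne' hkj.ne']
    have s₂ := lt_mul_swap (σ := σ * swap i k) hij (by rw [h₁i, h₁j]; exact hk.2)
    have s₃ := lt_mul_swap (σ := σ * swap i k * swap i j) hkj (by
      rw [Perm.mul_apply, Perm.mul_apply (σ * swap i k), swap_apply_right,
        swap_apply_of_ne_of_ne hik.ne' hkj.ne, h₁k, h₁i]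
      exact hk.1)
    rw [mul_assoc, mul_assoc, swap_mul_swap_mul_swap_eq hij.ne hkj.ne hik.ne, ← mul_assoc] at s₃
    exact h.2 (lt_mul_swap hik hk.1) (s₂.trans s₃)
  · rintro ⟨i, j, hij, hσ, he, rfl⟩
    refine ⟨lt_mul_swap hij hσ, fun c h₁ h₂ => ?_⟩
    have h₃ := length_lt_of_lt h₁
    have h₄ := length_lt_of_lt h₂
    simp only [length_eq_invCount] at h₃ h₄
    have h₅ := invCount_mul_swap hij hσ he
    omega

theorem swap_inj_of_lt {k l : Fin n} (hij : i < j) (hkl : k < l) (h : swap i j = swap k l) :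
    i = k ∧ j = l := by
  have h₁ := DFunLike.congr_fun h i
  have h₂ := DFunLike.congr_fun h j
  simp only [swap_apply_def] at h₁ h₂
  split_ifs at h₁ h₂ <;> omega

/-- The position of an index, as an integer coordinate. -/
def pos (i : Fin n) : ℤ := (i : ℕ)

/-- The value of a permutation at an index, as an integer coordinate. -/
def val (π : Perm (Fin n)) (i : Fin n) : ℤ := (π i : ℕ)

theorem pos_injective : Function.Injective (pos : Fin n → ℤ) := fun i j h => by
  simp only [pos] at h
  omega

theorem val_injective (π : Perm (Fin n)) : Function.Injective (val π) := fun i j h => by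
  simp only [val] at h
  exact π.injective (by omega)

open Classical in
/-- The total degree of `π` is the number of edges of the empty-rectangle graph of the points
`(i, π i)`. -/
theorem totalDegree_eq (π : Perm (Fin n)) : totalDegree π =
    (univ.filter fun p : Fin n × Fin n => p.1 < p.2 ∧ Adj pos (val π) univ p.1 p.2).card := by
  have hinj : ∀ A : Finset (Fin n × Fin n), (∀ p ∈ A, p.1 < p.2) →
      (A.image fun p => π * swap p.1 p.2).card = A.card := by
    intro A hA
    refine card_image_of_injOn fun p hp q hq h => ?_
    have := swap_inj_of_lt (hA p hp) (hA q hq) (mul_left_cancel h)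
    exact Prod.ext this.1 this.2
  have hup : {σ | π ⋖ σ} = ((univ.filter fun p : Fin n × Fin n => (p.1 < p.2 ∧
      Adj pos (val π) univ p.1 p.2) ∧ π p.1 < π p.2).image fun p => π * swap p.1 p.2 :
      Finset (Perm (Fin n))) := by
    ext σ
    simp only [Set.mem_ofPred_eq, covBy_iff, coe_image, Set.mem_image, mem_coe, mem_filter,
      mem_univ, true_and, Prod.exists]
    constructor
    · rintro ⟨i, j, hij, hπ, he, rfl⟩
      refine ⟨i, j, ⟨⟨hij, hij.ne, fun k _ h₁ h₂ => ?_⟩, hπ⟩, rfl⟩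
      have := he k
      simp only [Between, pos, val] at h₁ h₂
      omega
    · rintro ⟨i, j, ⟨⟨hij, -, he⟩, hπ⟩, rfl⟩
      refine ⟨i, j, hij, hπ, fun k h₁ h₂ h₃ => ?_, rfl⟩
      have := he k (mem_univ k)
      simp only [Between, pos, val] at this
      omega
  have hdown : {σ | σ ⋖ π} = ((univ.filter fun p : Fin n × Fin n => (p.1 < p.2 ∧
      Adj pos (val π) univ p.1 p.2) ∧ ¬ π p.1 < π p.2).image fun p => π * swap p.1 p.2 :
      Finset (Perm (Fin n))) := by
    ext σ
    simp only [Set.mem_ofPred_eq, covBy_iff, coe_image, Set.mem_image, mem_coe, mem_filter,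
      mem_univ, true_and, Prod.exists]
    constructor
    · rintro ⟨i, j, hij, hσ, he, rfl⟩
      refine ⟨i, j, ⟨⟨hij, hij.ne, fun k _ h₁ h₂ => ?_⟩, ?_⟩, ?_⟩
      · have := he k
        simp only [Between, pos, val, Perm.mul_apply, swap_apply_left, swap_apply_right]
          at h₁ h₂
        rw [swap_apply_of_ne_of_ne (by omega) (by omega)] at h₂
        omega
      · simpa using hσ.le
      · rw [mul_assoc, swap_mul_self, mul_one]
    · rintro ⟨i, j, ⟨⟨hij, -, he⟩, hπ⟩, rfl⟩
      have hne := π.injective.ne hij.ne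
      refine ⟨i, j, hij, ?_, fun k h₁ h₂ h₃ => ?_, ?_⟩
      · simpa using lt_of_le_of_ne (not_lt.1 hπ) hne.symm
      · have := he k (mem_univ k)
        simp only [Perm.mul_apply, swap_apply_left, swap_apply_right] at h₃
        rw [swap_apply_of_ne_of_ne (by omega) (by omega)] at h₃
        simp only [Between, pos, val] at this
        omega
      · rw [mul_assoc, swap_mul_self, mul_one]
  rw [totalDegree, downDegree, upDegree, hup, hdown, Set.ncard_coe_finset, Set.ncard_coe_finset,
    hinj _ fun p hp => (mem_filter.1 hp).2.1.1, hinj _ fun p hp => (mem_filter.1 hp).2.1.1,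
    add_comm, ← card_filter_add_card_filter_not (s := univ.filter fun p : Fin n × Fin n =>
      p.1 < p.2 ∧ Adj pos (val π) univ p.1 p.2) (fun p => π p.1 < π p.2), filter_filter,
    filter_filter]

theorem adjCount_eq (π : Perm (Fin n)) :
    adjCount pos (val π) univ univ = 2 * totalDegree π := by
  classical
  rw [totalDegree_eq, adjCount, univ_product_univ,
    ← card_filter_add_card_filter_not (fun p : Fin n × Fin n => p.1 < p.2), filter_filter,
    filter_filter, two_mul]
  congr 1
  · congr 1
    ext p
    simp only [mem_filter, and_comm]
  · refine card_bij' (fun p _ => p.swap) (fun p _ => p.swap) ?_ ?_ ?_ ?_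
    · rintro ⟨i, j⟩ hp
      simp only [mem_filter, mem_univ, true_and, Prod.swap] at hp ⊢
      exact ⟨lt_of_le_of_ne (not_lt.1 hp.2) hp.1.1.symm, hp.1.symm⟩
    · rintro ⟨i, j⟩ hp
      simp only [mem_filter, mem_univ, true_and, Prod.swap] at hp ⊢
      exact ⟨hp.2.symm, hp.1.le.not_gt⟩
    · exact fun _ _ => rfl
    · exact fun _ _ => rfl

theorem totalDegree_le (hn : 2 ≤ n) (π : Perm (Fin n)) : totalDegree π ≤ edgeBound n := by
  have h := adjCount_le_edgeBound (S := univ) pos_injective (val_injective π) (by simpa using hn)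
  rw [adjCount_eq, card_univ, Fintype.card_fin] at h
  omega

theorem isMaximal_iff (hn : 2 ≤ n) (π : Perm (Fin n)) :
    IsMaximal pos (val π) univ ↔ totalDegree π = edgeBound n := by
  have h := totalDegree_le hn π
  rw [IsMaximal, adjCount_eq, card_univ, Fintype.card_fin]
  omega

end Bruhat

/-! ### The normal form of an oriented frame -/

namespace Frame

variable {V : Type*} {x y : V → ℤ} {S : Finset V} {L R T B : V}

/-- The lower left and the upper right quadrant are empty, or else the upper left and the lower
right one are. -/
theorem oriented_or (F : Frame x y S L R T B) :
    (∀ p ∈ S, ¬ (x p < x T ∧ x p < x B ∧ y p < y L ∧ y p < y R) ∧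
      ¬ (x T < x p ∧ x B < x p ∧ y L < y p ∧ y R < y p)) ∨
    (∀ p ∈ S, ¬ (x T < x p ∧ x B < x p ∧ y p < y L ∧ y p < y R) ∧
      ¬ (x p < x T ∧ x p < x B ∧ y L < y p ∧ y R < y p)) := by
  have hl : ∀ p ∈ S, ∀ q ∈ S, (x p < x T ∧ x p < x B ∧ y p < y L ∧ y p < y R) →
      ¬ (x q < x T ∧ x q < x B ∧ y L < y q ∧ y R < y q) := fun p hp q hq h₁ h₂ =>
    F.not_upper_left_lower_left hq h₂.1 h₂.2.2.1 hp h₁.2.1 h₁.2.2.1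
  have hu : ∀ p ∈ S, ∀ q ∈ S, (x T < x p ∧ x B < x p ∧ y L < y p ∧ y R < y p) →
      ¬ (x q < x T ∧ x q < x B ∧ y L < y q ∧ y R < y q) := fun p hp q hq h₁ h₂ =>
    F.not_upper_left_upper_right hq h₂.1 h₂.2.2.1 hp h₁.1 h₁.2.2.2
  have hb : ∀ p ∈ S, ∀ q ∈ S, (x p < x T ∧ x p < x B ∧ y p < y L ∧ y p < y R) →
      ¬ (x T < x q ∧ x B < x q ∧ y q < y L ∧ y q < y R) := fun p hp q hq h₁ h₂ =>
    F.flip_y.not_upper_left_upper_right hp h₁.2.1 (by omega) hq h₂.2.1 (by omega)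
  have hr : ∀ p ∈ S, ∀ q ∈ S, (x T < x p ∧ x B < x p ∧ y L < y p ∧ y R < y p) →
      ¬ (x T < x q ∧ x B < x q ∧ y q < y L ∧ y q < y R) := fun p hp q hq h₁ h₂ =>
    F.flip_x.not_upper_left_lower_left hp (by omega) h₁.2.2.2 hq (by omega) h₂.2.2.2
  by_cases h₁ : ∃ p ∈ S, x p < x T ∧ x p < x B ∧ y p < y L ∧ y p < y R
  · obtain ⟨p, hp, h⟩ := h₁
    exact Or.inr fun q hq => ⟨hb p hp q hq h, hl p hp q hq h⟩
  by_cases h₂ : ∃ p ∈ S, x T < x p ∧ x B < x p ∧ y L < y p ∧ y R < y p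
  · obtain ⟨p, hp, h⟩ := h₂
    exact Or.inr fun q hq => ⟨hr p hp q hq h, hu p hp q hq h⟩
  exact Or.inl fun p hp => ⟨fun h => h₁ ⟨p, hp, h⟩, fun h => h₂ ⟨p, hp, h⟩⟩

/-- Rotation by 180 degrees preserves the orientation of a frame. -/
theorem oriented_rotate
    (ho : ∀ p ∈ S, ¬ (x p < x T ∧ x p < x B ∧ y p < y L ∧ y p < y R) ∧
      ¬ (x T < x p ∧ x B < x p ∧ y L < y p ∧ y R < y p)) :
    ∀ p ∈ S, ¬ (-x p < -x B ∧ -x p < -x T ∧ -y p < -y R ∧ -y p < -y L) ∧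
      ¬ (-x B < -x p ∧ -x T < -x p ∧ -y R < -y p ∧ -y L < -y p) := fun p hp => by
  have := ho p hp
  omega

section Normal

variable (F : Frame x y S L R T B)
  (ho : ∀ p ∈ S, ¬ (x p < x T ∧ x p < x B ∧ y p < y L ∧ y p < y R) ∧
      ¬ (x T < x p ∧ x B < x p ∧ y L < y p ∧ y R < y p))
  (hTB : x T < x B)

include F ho hTB

/-- The points to the left of `B` are `L`, `T` and the upper left quadrant. -/
theorem eq_or_upper_left {p : V} (hp : p ∈ S) (hpB : x p < x B) :
    p = L ∨ p = T ∨ (x p < x T ∧ y L < y p ∧ y R < y p) := by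
  by_cases hL : p = L
  · exact Or.inl hL
  by_cases hT : p = T
  · exact Or.inr (Or.inl hT)
  have hR := F.right_right
  have h₁ := F.left_or_right hp hT (fun h => by subst h; omega)
  have h₂ := F.above_or_below hp hL (fun h => by subst h; omega)
  have h₃ := (ho p hp).1
  omega

theorem left_strictMono {p q : V} (hp : p ∈ S) (hq : q ∈ S) (hqB : x q < x B) (hpq : x p < x q) :
    y p < y q := by
  have hLT := F.top_above
  rcases F.eq_or_upper_left ho hTB hp (hpq.trans hqB) with rfl | rfl | h <;>
  rcases F.eq_or_upper_left ho hTB hq hqB with rfl | rfl | h'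
  · omega
  · omega
  · omega
  · have := F.left_left
    omega
  · omega
  · omega
  · have := F.left_lt hp (fun h => by subst h; omega)
    omega
  · exact F.lt_top hp (fun h => by subst h; omega)
  · exact F.upper_left_chain hp h.1 (by omega) h.2.1 h.2.2 hq h'.1 hqB h'.2.1 h'.2.2 hpq

theorem left_high {p : V} (hp : p ∈ S) (hpB : x p < x B) : y L ≤ y p := by
  have hLT := F.top_above
  rcases F.eq_or_upper_left ho hTB hp hpB with rfl | rfl | h <;> omega

/-- The neighbours of `L` are at most one point on its own side and points on the side of `R`. -/
theorem half_le_card_right : S.card / 2 ≤ (S.filter fun p => x B ≤ x p).card := by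
  classical
  have h₁ := F.isMaximal.half_lt_deg F.inj_x F.inj_y (by have := F.four_le; omega) F.left.1
  have h₂ := card_filter_add_card_filter_not (s := nbrs x y S L) (fun p => x B ≤ x p)
  have h₃ : ((nbrs x y S L).filter fun p => x B ≤ x p).card ≤
      (S.filter fun p => x B ≤ x p).card :=
    card_le_card (filter_subset_filter _ (filter_subset _ _))
  have h₄ : ((nbrs x y S L).filter fun p => ¬ x B ≤ x p).card ≤ 1 := by
    refine card_le_one.2 fun p hp q hq => ?_
    simp only [mem_filter, mem_nbrs, not_le] at hp hq
    have key : ∀ p q, p ∈ S → q ∈ S → Adj x y S L p → Adj x y S L q → x q < x B →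
        ¬ x p < x q := by
      intro p q hp hq hLp hLq hqB hpq
      have g₁ := F.left_lt hp hLp.1.symm
      have g₂ := F.left_strictMono ho hTB hp hq hqB hpq
      have g₃ := F.left_strictMono ho hTB F.left.1 hp (hpq.trans hqB) g₁
      exact not_adj_of_between hp (Or.inl ⟨g₁, hpq⟩) (Or.inl ⟨g₃, g₂⟩) hLq
    have k₁ := key p q hp.1.1 hq.1.1 hp.1.2 hq.1.2 hq.2
    have k₂ := key q p hq.1.1 hp.1.1 hq.1.2 hp.1.2 hp.2
    exact F.inj_x (by omega)
  omega

theorem right_strictMono {p q : V} (hp : p ∈ S) (hq : q ∈ S) (hpB : x B ≤ x p)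
    (hpq : x p < x q) : y p < y q := by
  have := F.flip_x.flip_y.left_strictMono (oriented_rotate ho) (by omega) hq hp
    (by omega) (by omega)
  omega

theorem right_low {p : V} (hp : p ∈ S) (hpB : x B ≤ x p) : y p ≤ y R := by
  have := F.flip_x.flip_y.left_high (oriented_rotate ho) (by omega) hp (by omega)
  omega

theorem half_le_card_left : S.card / 2 ≤ (S.filter fun p => x p < x B).card := by
  refine (F.flip_x.flip_y.half_le_card_right (oriented_rotate ho) (by omega)).trans ?_
  refine card_le_card fun p hp => ?_
  simp only [mem_filter] at hp ⊢
  exact ⟨hp.1, by omega⟩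

end Normal

end Frame

/-! ### Symmetries of the total degree -/

theorem adjCount_comp {V : Type*} [Fintype V] (x y : V → ℤ) (e : Perm V) :
    adjCount (x ∘ e) (y ∘ e) univ univ = adjCount x y univ univ := by
  classical
  have h : ∀ u v, Adj (x ∘ e) (y ∘ e) univ u v ↔ Adj x y univ (e u) (e v) := by
    intro u v
    simp only [Adj, ne_eq, e.injective.eq_iff, mem_univ, forall_const, Function.comp]
    exact and_congr_right fun _ => ⟨fun h w => by simpa using h (e.symm w), fun h w => h (e w)⟩
  unfold adjCount
  refine card_bij' (fun p _ => (e p.1, e p.2)) (fun p _ => (e.symm p.1, e.symm p.2)) ?_ ?_ ?_ ?_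
  · intro p hp
    simpa [h] using hp
  · intro p hp
    simpa [h] using hp
  · intro p _
    simp
  · intro p _
    simp

section Perm

variable {n : ℕ} (hn : 2 ≤ n) {π : Perm (Fin n)}

theorem totalDegree_inv (π : Perm (Fin n)) : totalDegree π⁻¹ = totalDegree π := by
  have h₁ := adjCount_eq π⁻¹
  have h₂ := adjCount_eq π
  rw [← adjCount_comp _ _ π] at h₁
  have e₁ : (pos ∘ π : Fin n → ℤ) = val π := rfl
  have e₂ : val π⁻¹ ∘ π = pos := by
    funext i
    simp [val, pos]
  rw [e₁, e₂, adjCount_swap] at h₁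
  omega

theorem totalDegree_mul_revPerm (π : Perm (Fin n)) :
    totalDegree (π * Fin.revPerm) = totalDegree π := by
  have h₁ := adjCount_eq (π * Fin.revPerm)
  have h₂ := adjCount_eq π
  rw [← adjCount_comp _ _ Fin.revPerm] at h₁
  have e₂ : val (π * Fin.revPerm) ∘ Fin.revPerm = val π := by
    funext i
    simp [val]
  have e₁ : ∀ y : Fin n → ℤ, adjCount (pos ∘ Fin.revPerm) y univ univ =
      adjCount pos y univ univ := by
    intro y
    have : ∀ u v, Adj (pos ∘ Fin.revPerm) y univ u v ↔ Adj pos y univ u v := by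
      intro u v
      refine and_congr_right fun _ => forall_congr' fun w => forall_congr' fun _ => ?_
      have : Between ((pos ∘ Fin.revPerm) u) ((pos ∘ Fin.revPerm) v) ((pos ∘ Fin.revPerm) w) ↔
          Between (pos u) (pos v) (pos w) := by
        simp only [Between, pos, Function.comp, Fin.revPerm_apply, Fin.val_rev]
        omega
      rw [this]
    unfold adjCount
    congr 1
    ext p
    simp only [mem_filter, this]
  rw [e₂, e₁] at h₁
  omega

/-- The first position, and the smallest value. -/
abbrev first : Fin n := ⟨0, by omega⟩

/-- The last position, and the largest value. -/
abbrev last : Fin n := ⟨n - 1, by omega⟩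

theorem isLeftmost_first : IsLeftmost pos univ (first hn) :=
  ⟨mem_univ _, fun w _ hw => by
    have : (w : ℕ) ≠ 0 := fun h => hw (Fin.ext h)
    simp only [pos]
    omega⟩

theorem isLeftmost_last : IsLeftmost (fun i => -pos i) univ (last hn) :=
  ⟨mem_univ _, fun w _ hw => by
    have : (w : ℕ) ≠ n - 1 := fun h => hw (Fin.ext h)
    simp only [pos]
    omega⟩

theorem isLeftmost_inv_first (π : Perm (Fin n)) : IsLeftmost (val π) univ (π⁻¹ (first hn)) :=
  ⟨mem_univ _, fun w _ hw => by
    have : (π w : ℕ) ≠ 0 := fun h => hw ((Perm.eq_inv_iff_eq).2 (Fin.ext h))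
    have e : π (π⁻¹ (first hn)) = first hn := π.apply_symm_apply _
    simp only [val, e]
    omega⟩

theorem isLeftmost_inv_last (π : Perm (Fin n)) :
    IsLeftmost (fun i => -val π i) univ (π⁻¹ (last hn)) :=
  ⟨mem_univ _, fun w _ hw => by
    have : (π w : ℕ) ≠ n - 1 := fun h => hw ((Perm.eq_inv_iff_eq).2 (Fin.ext h))
    have e : π (π⁻¹ (last hn)) = last hn := π.apply_symm_apply _
    simp only [val, e]
    omega⟩

theorem adj_first_last (h : totalDegree π = edgeBound n) :
    Adj pos (val π) univ (first hn) (last hn) :=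
  ((isMaximal_iff hn π).2 h).adj_left_right pos_injective (val_injective π) (by simpa using hn)
    (isLeftmost_first hn) (isLeftmost_last hn)

theorem frame_of_maximal (h4 : 4 ≤ n) (h : totalDegree π = edgeBound n) :
    Frame pos (val π) univ (first hn) (last hn) (π⁻¹ (last hn)) (π⁻¹ (first hn)) where
  inj_x := pos_injective
  inj_y := val_injective π
  four_le := by simpa using h4
  isMaximal := (isMaximal_iff hn π).2 h
  left := isLeftmost_first hn
  right := isLeftmost_last hn
  top := isLeftmost_inv_last hn π
  bottom := isLeftmost_inv_first hn π
  adj_left_right := adj_first_last hn h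
  adj_top_bottom := (((isMaximal_iff hn π).2 h).swap.adj_left_right (val_injective π)
    pos_injective (by simpa using hn) (isLeftmost_inv_first hn π)
    (isLeftmost_inv_last hn π)).symm.swap

/-- If the first and the last point of `π` are adjacent, no height separates them, and
interchanging their heights does not affect the empty-rectangle graph. -/
theorem totalDegree_mul_endsSwap (h : totalDegree π = edgeBound n) :
    totalDegree (π * endsSwap n hn) = edgeBound n := by
  classical
  have hadj := adj_first_last hn h
  have hne : ∀ u v w : Fin n, Between (pos u) (pos v) (pos w) → w ≠ first hn ∧ w ≠ last hn := by
    intro u v w hw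
    simp only [Between, pos] at hw
    constructor <;> (rintro rfl; simp only at hw; omega)
  have hval : ∀ u w, w ≠ first hn → w ≠ last hn →
      val (π * endsSwap n hn) w = val π w ∧
      (val (π * endsSwap n hn) u < val π w ↔ val π u < val π w) ∧
      (val π w < val (π * endsSwap n hn) u ↔ val π w < val π u) := by
    intro u w h₁ h₂
    have hb := hadj.2 w (mem_univ w)
    have n₁ := (val_injective π).ne h₁
    have n₂ := (val_injective π).ne h₂
    have g₁ : (w : ℕ) ≠ 0 := fun h => h₁ (Fin.ext h)
    have g₂ : (w : ℕ) ≠ n - 1 := fun h => h₂ (Fin.ext h)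
    replace hb := hb (Or.inl (by simp only [pos]; omega))
    unfold Between at hb
    refine ⟨by simp [val, endsSwap, swap_apply_of_ne_of_ne h₁ h₂], ?_⟩
    by_cases hu₁ : u = first hn
    · have : val (π * endsSwap n hn) u = val π (last hn) := by simp [val, endsSwap, hu₁]
      rw [this, hu₁]
      omega
    · by_cases hu₂ : u = last hn
      · have : val (π * endsSwap n hn) u = val π (first hn) := by simp [val, endsSwap, hu₂]
        rw [this, hu₂]
        omega
      · have : val (π * endsSwap n hn) u = val π u := by
          simp [val, endsSwap, swap_apply_of_ne_of_ne hu₁ hu₂]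
        rw [this]
        exact ⟨Iff.rfl, Iff.rfl⟩
  have key : ∀ u v, Adj pos (val (π * endsSwap n hn)) univ u v ↔ Adj pos (val π) univ u v := by
    intro u v
    refine and_congr_right fun _ => forall_congr' fun w => forall_congr' fun _ =>
      forall_congr' fun hw => not_congr ?_
    obtain ⟨h₁, h₂⟩ := hne u v w hw
    have hu := hval u w h₁ h₂
    have hv := hval v w h₁ h₂
    unfold Between
    rw [hu.1]
    omega
  rw [← h, totalDegree_eq, totalDegree_eq]
  simp only [key]

theorem endsSwap_mul_self : endsSwap n hn * endsSwap n hn = 1 := swap_mul_self _ _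

theorem endsSwap_inv : (endsSwap n hn)⁻¹ = endsSwap n hn := swap_inv _ _

theorem totalDegree_endsSwap_mul (h : totalDegree π = edgeBound n) :
    totalDegree (endsSwap n hn * π) = edgeBound n := by
  rw [← totalDegree_inv, mul_inv_rev, endsSwap_inv]
  exact totalDegree_mul_endsSwap hn (by rw [totalDegree_inv, h])

/-! ### The block permutations -/

theorem blockPerm_apply {m : ℕ} (hm : m ≤ n) (i : Fin n) :
    (blockPerm n m hm i : ℕ) = if (i : ℕ) < n - m then m + i else i - (n - m) := by
  simp only [blockPerm, coe_fn_mk]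
  split_ifs <;> rfl

theorem le_totalDegree_blockPerm {m : ℕ} (hm : m ≤ n) (h0 : 0 < m) (h1 : m < n) :
    (n - m) * m + (n - 2) ≤ totalDegree (blockPerm n m hm) := by
  classical
  have hcross : Disjoint (range (n - m) ×ˢ Ico (n - m) n)
      (((range (n - 1)).erase (n - m - 1)).image fun i => (i, i + 1)) := by
    refine disjoint_left.2 fun p hp hp' => ?_
    simp only [mem_product, mem_range, mem_Ico, mem_image, mem_erase] at hp hp'
    obtain ⟨i, hi, rfl⟩ := hp'
    simp only at hp
    omega
  have hcard : ((range (n - m) ×ˢ Ico (n - m) n) ∪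
      (((range (n - 1)).erase (n - m - 1)).image fun i => (i, i + 1))).card =
      (n - m) * m + (n - 2) := by
    rw [card_union_of_disjoint hcross, card_product, card_range, Nat.card_Ico,
      card_image_of_injective _ (fun a b h => (Prod.ext_iff.1 h).1),
      card_erase_of_mem (by rw [mem_range]; omega), card_range, Nat.sub_sub_self hm]
    omega
  rw [← hcard, totalDegree_eq, ← card_image_of_injective (f := fun p : Fin n × Fin n =>
    ((p.1 : ℕ), (p.2 : ℕ))) _ (fun a b h => Prod.ext (Fin.ext (Prod.ext_iff.1 h).1)
      (Fin.ext (Prod.ext_iff.1 h).2))]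
  refine card_le_card fun p hp => ?_
  obtain ⟨i, j⟩ := p
  simp only [mem_union, mem_product, mem_range, mem_Ico, mem_image, mem_erase,
    Prod.mk.injEq] at hp
  have hij : i < j ∧ j < n := by
    rcases hp with hp | ⟨a, ha, rfl, rfl⟩ <;> omega
  refine mem_image.2 ⟨(⟨i, by omega⟩, ⟨j, by omega⟩), mem_filter.2 ⟨mem_univ _, ?_, ?_, ?_⟩, rfl⟩
  · exact hij.1
  · exact fun h => hij.1.ne (congrArg Fin.val h)
  · intro w _ h₁ h₂
    simp only [Between, pos, val, blockPerm_apply] at h₁ h₂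
    have hw := w.isLt
    rcases hp with hp | ⟨a, ha, rfl, rfl⟩
    · split_ifs at h₂ <;> omega
    · omega

include hn in
theorem totalDegree_blockPerm {m : ℕ} (hm : m ≤ n) (h : m = n / 2 ∨ m = (n + 1) / 2) :
    totalDegree (blockPerm n m hm) = edgeBound n := by
  have h₁ := le_totalDegree_blockPerm hm (by omega) (by omega)
  have h₂ := totalDegree_le hn (blockPerm n m hm)
  have h₃ : n ^ 2 / 4 = (n - m) * m := by
    obtain ⟨k, rfl | rfl⟩ := n.even_or_odd'
    · obtain rfl : m = k := by omega
      rw [show 2 * m - m = m by omega, show (2 * m) ^ 2 = 4 * (m * m) by ring]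
      omega
    · have e : (2 * k + 1) ^ 2 = 4 * (k * (k + 1)) + 1 := by ring
      rcases h with h | h
      · obtain rfl : m = k := by omega
        rw [show 2 * m + 1 - m = m + 1 by omega, mul_comm (m + 1)]
        omega
      · obtain rfl : m = k + 1 := by omega
        rw [show 2 * k + 1 - (k + 1) = k by omega]
        omega
  unfold edgeBound at *
  omega

theorem totalDegree_of_hasExtremalForm (h : HasExtremalForm n hn π) :
    totalDegree π = edgeBound n := by
  induction h with
  | floor => exact totalDegree_blockPerm hn _ (Or.inl rfl)
  | ceil => exact totalDegree_blockPerm hn _ (Or.inr rfl)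
  | reverse π _ ih => rw [totalDegree_mul_revPerm, ih]
  | swapEnds π _ ih => exact totalDegree_mul_endsSwap hn ih
  | swapValues π _ ih => exact totalDegree_endsSwap_mul hn ih

/-! ### Maximal permutations have the extremal form -/

/-- No point of `π` is to the left of both the smallest and the largest value and below both the
first and the last point, and no point is to the right and above. -/
def Oriented (π : Perm (Fin n)) : Prop :=
  ∀ p, ¬ (p < π⁻¹ (last hn) ∧ p < π⁻¹ (first hn) ∧ π p < π (first hn) ∧ π p < π (last hn)) ∧
    ¬ (π⁻¹ (last hn) < p ∧ π⁻¹ (first hn) < p ∧ π (first hn) < π p ∧ π (last hn) < π p)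

theorem Oriented.inv (h : Oriented hn π) : Oriented hn π⁻¹ := fun p => by
  have := h (π⁻¹ p)
  have e : π (π⁻¹ p) = p := π.apply_symm_apply p
  rw [e] at this
  rw [inv_inv]
  tauto

theorem Oriented.mul_endsSwap (h : Oriented hn π) (h₁ : π⁻¹ (first hn) ≠ first hn)
    (h₂ : π⁻¹ (first hn) ≠ last hn) (h₃ : π⁻¹ (last hn) ≠ first hn)
    (h₄ : π⁻¹ (last hn) ≠ last hn) : Oriented hn (π * endsSwap n hn) := fun p => by
  have e₁ : (π * endsSwap n hn)⁻¹ (first hn) = π⁻¹ (first hn) := by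
    rw [mul_inv_rev, endsSwap_inv, Perm.mul_apply, endsSwap, swap_apply_of_ne_of_ne h₁ h₂]
  have e₂ : (π * endsSwap n hn)⁻¹ (last hn) = π⁻¹ (last hn) := by
    rw [mul_inv_rev, endsSwap_inv, Perm.mul_apply, endsSwap, swap_apply_of_ne_of_ne h₃ h₄]
  have e₃ : (π * endsSwap n hn) (first hn) = π (last hn) := by simp [endsSwap]
  have e₄ : (π * endsSwap n hn) (last hn) = π (first hn) := by simp [endsSwap]
  rw [e₁, e₂, e₃, e₄]
  by_cases hp₁ : p = first hn
  · subst hp₁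
    rw [e₃]
    omega
  · by_cases hp₂ : p = last hn
    · subst hp₂
      rw [e₄]
      omega
    · have : (π * endsSwap n hn) p = π p := by
        simp [endsSwap, swap_apply_of_ne_of_ne hp₁ hp₂]
      rw [this]
      have := h p
      tauto

theorem oriented_or_oriented_reverse (h4 : 4 ≤ n) (h : totalDegree π = edgeBound n) :
    Oriented hn π ∨ Oriented hn (π * Fin.revPerm) := by
  rcases (frame_of_maximal hn h4 h).oriented_or with ho | ho
  · refine Or.inl fun p => ?_
    have := ho p (mem_univ p)
    simp only [pos, val] at this
    simp only [Fin.lt_def]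
    omega
  · refine Or.inr fun p => ?_
    have := ho p.rev (mem_univ _)
    have hf : (first hn).rev = last hn := Fin.ext (by simp [Fin.val_rev])
    have hl : (last hn).rev = first hn := Fin.ext (by simp [Fin.val_rev]; omega)
    have e : ∀ v : Fin n, (π * Fin.revPerm : Perm (Fin n))⁻¹ v = (π⁻¹ v).rev := fun v => rfl
    rw [e, e, Perm.mul_apply, Perm.mul_apply, Perm.mul_apply, Fin.revPerm_apply,
      Fin.revPerm_apply, Fin.revPerm_apply, hf, hl]
    simp only [pos, val, Fin.val_rev] at this
    simp only [Fin.lt_def, Fin.val_rev]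
    omega

theorem ends_ne (h4 : 4 ≤ n) (h : totalDegree π = edgeBound n) :
    π⁻¹ (first hn) ≠ first hn ∧ π⁻¹ (first hn) ≠ last hn ∧ π⁻¹ (last hn) ≠ first hn ∧
      π⁻¹ (last hn) ≠ last hn := by
  have F := frame_of_maximal hn h4 h
  have h₁ := F.left_left
  have h₂ := F.right_right
  refine ⟨fun h => ?_, fun h => ?_, fun h => ?_, fun h => ?_⟩ <;> rw [h] at h₁ h₂ <;> omega

theorem eq_blockPerm (h4 : 4 ≤ n) (h : totalDegree π = edgeBound n) (ho : Oriented hn π)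
    (h₁ : π (last hn) < π (first hn)) (h₂ : π⁻¹ (last hn) < π⁻¹ (first hn)) :
    ∃ (m : ℕ) (hm : m ≤ n), (m = n / 2 ∨ m = (n + 1) / 2) ∧ π = blockPerm n m hm := by
  have F := frame_of_maximal hn h4 h
  have ho' : ∀ p ∈ (univ : Finset (Fin n)),
      ¬ (pos p < pos (π⁻¹ (last hn)) ∧ pos p < pos (π⁻¹ (first hn)) ∧
        val π p < val π (first hn) ∧ val π p < val π (last hn)) ∧
      ¬ (pos (π⁻¹ (last hn)) < pos p ∧ pos (π⁻¹ (first hn)) < pos p ∧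
        val π (first hn) < val π p ∧ val π (last hn) < val π p) := fun p _ => by
    have := ho p
    simp only [Fin.lt_def] at this
    simp only [pos, val]
    omega
  have hTB : pos (π⁻¹ (last hn)) < pos (π⁻¹ (first hn)) := by
    simp only [pos]
    omega
  have g₁ := F.half_le_card_left ho' hTB
  have g₂ := F.half_le_card_right ho' hTB
  have g₃ := card_filter_add_card_filter_not (s := (univ : Finset (Fin n)))
    (fun p => pos p < pos (π⁻¹ (first hn)))
  have g₄ : (univ.filter fun p : Fin n => pos p < pos (π⁻¹ (first hn))).card =
      (π⁻¹ (first hn) : ℕ) := by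
    have : (univ.filter fun p : Fin n => pos p < pos (π⁻¹ (first hn))) =
        Iio (π⁻¹ (first hn)) := by
      ext p
      simp [pos]
    rw [this, Fin.card_Iio]
  simp only [not_lt] at g₃
  rw [g₄] at g₁ g₃
  rw [card_univ, Fintype.card_fin] at g₁ g₂ g₃
  have hlow := fun p => F.right_low ho' hTB (mem_univ p)
  have hhigh := fun p => F.left_high ho' hTB (mem_univ p)
  have hml := fun p q => F.left_strictMono ho' hTB (mem_univ p) (mem_univ q)
  have hmr := fun p q => F.right_strictMono ho' hTB (mem_univ p) (mem_univ q)
  generalize π⁻¹ (first hn) = b at *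
  have hb := b.isLt
  refine ⟨n - b, by omega, by omega, ?_⟩
  have hβ := blockPerm_apply (n := n) (m := n - b) (by omega)
  generalize blockPerm n (n - b) _ = β at hβ
  rw [← mul_inv_eq_one]
  refine eq_one_of_strictMono fun i j hij => ?_
  obtain ⟨p, rfl⟩ := β.surjective i
  obtain ⟨q, rfl⟩ := β.surjective j
  have e : ∀ p, (π * β⁻¹) (β p) = π p := fun p => congrArg π (β.symm_apply_apply p)
  rw [e, e]
  rw [Fin.lt_def, hβ, hβ] at hij
  have k₁ := hlow p
  have k₂ := hhigh q
  have k₃ := hml p q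
  have k₄ := hmr p q
  have hp := p.isLt
  have hq := q.isLt
  rw [Fin.lt_def]
  rw [Fin.lt_def] at h₁
  simp only [pos, val] at k₁ k₂ k₃ k₄
  split_ifs at hij <;> omega

theorem hasExtremalForm_of_oriented (h4 : 4 ≤ n) (h : totalDegree π = edgeBound n)
    (ho : Oriented hn π) : HasExtremalForm n hn π := by
  have hne : first hn ≠ last hn := fun h => by
    have := congrArg Fin.val h
    simp only at this
    omega
  wlog h₁ : π (last hn) < π (first hn) generalizing π
  · obtain ⟨e₁, e₂, e₃, e₄⟩ := ends_ne hn h4 h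
    have := this (totalDegree_mul_endsSwap hn h) (ho.mul_endsSwap hn e₁ e₂ e₃ e₄) (by
      simpa [endsSwap] using lt_of_le_of_ne (not_lt.1 h₁) (π.injective.ne hne))
    simpa [mul_assoc, endsSwap_mul_self] using this.swapEnds
  wlog h₂ : π⁻¹ (last hn) < π⁻¹ (first hn) generalizing π
  · obtain ⟨e₁, e₂, e₃, e₄⟩ := ends_ne hn h4 h
    have ho' : Oriented hn (endsSwap n hn * π) := by
      have hi : totalDegree π⁻¹ = edgeBound n := by rw [totalDegree_inv, h]
      obtain ⟨d₁, d₂, d₃, d₄⟩ := ends_ne hn h4 hi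
      have := ((ho.inv hn).mul_endsSwap hn d₁ d₂ d₃ d₄).inv
      rwa [mul_inv_rev, endsSwap_inv, inv_inv] at this
    have f₁ : π (first hn) ≠ first hn := fun h => e₁ (by rw [Perm.inv_eq_iff_eq, h])
    have f₂ : π (last hn) ≠ first hn := fun h => e₂ (by rw [Perm.inv_eq_iff_eq, h])
    have f₃ : π (first hn) ≠ last hn := fun h => e₃ (by rw [Perm.inv_eq_iff_eq, h])
    have f₄ : π (last hn) ≠ last hn := fun h => e₄ (by rw [Perm.inv_eq_iff_eq, h])
    have := this (totalDegree_endsSwap_mul hn h) ho' (by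
      simpa [endsSwap, swap_apply_of_ne_of_ne f₁ f₃, swap_apply_of_ne_of_ne f₂ f₄] using h₁) (by
      rw [mul_inv_rev, endsSwap_inv]
      simpa [endsSwap] using lt_of_le_of_ne (not_lt.1 h₂) (π⁻¹.injective.ne hne))
    simpa [← mul_assoc, endsSwap_mul_self] using this.swapValues
  obtain ⟨m, hm, rfl | rfl, rfl⟩ := eq_blockPerm hn h4 h ho h₁ h₂
  · exact .floor
  · exact .ceil

end Perm

section Family

variable {n : ℕ} (hn : 2 ≤ n) {π : Perm (Fin n)}

/-! ### Counting the extremal forms -/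

theorem endsSwap_mul_revPerm :
    endsSwap n hn * Fin.revPerm = Fin.revPerm * endsSwap n hn := by
  have h₁ : Fin.revPerm (first hn) = last hn := Fin.ext (by simp [Fin.val_rev])
  have h₂ : Fin.revPerm (last hn) = first hn := Fin.ext (by simp [Fin.val_rev]; omega)
  rw [endsSwap, mul_swap_eq_swap_mul, h₁, h₂, swap_comm]

theorem revPerm_mul_self : (Fin.revPerm * Fin.revPerm : Perm (Fin n)) = 1 := by
  ext i
  simp

/-- The permutations obtained from the two block permutations: as the three operations commute and
are involutions, each of them is applied at most once. The index `d` chooses the block length, and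
`a`, `b`, `c` tell whether values are interchanged, ends are interchanged, and the sequence is
reversed. -/
def extremalPerm (d a b c : Bool) : Perm (Fin n) :=
  (bif a then endsSwap n hn else 1) *
    blockPerm n ((n + d.toNat) / 2) (by have := d.toNat_le; omega) *
    (bif b then endsSwap n hn else 1) * (bif c then Fin.revPerm else 1)

theorem hasExtremalForm_iff :
    HasExtremalForm n hn π ↔ ∃ d a b c, extremalPerm hn d a b c = π := by
  have hE := endsSwap_mul_self hn
  have hR := revPerm_mul_self (n := n)
  have hER := endsSwap_mul_revPerm hn
  constructor
  · intro h
    induction h with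
    | floor => exact ⟨false, false, false, false, by simp [extremalPerm]⟩
    | ceil => exact ⟨true, false, false, false, by simp [extremalPerm]⟩
    | reverse π _ ih =>
      obtain ⟨d, a, b, c, rfl⟩ := ih
      refine ⟨d, a, b, !c, ?_⟩
      cases c <;> simp [extremalPerm, mul_assoc, hR]
    | swapEnds π _ ih =>
      obtain ⟨d, a, b, c, rfl⟩ := ih
      refine ⟨d, a, !b, c, ?_⟩
      cases b <;> cases c <;> simp [extremalPerm, mul_assoc, hE, ← hER]
      rw [← mul_assoc (endsSwap n hn) (endsSwap n hn), hE, one_mul]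
    | swapValues π _ ih =>
      obtain ⟨d, a, b, c, rfl⟩ := ih
      refine ⟨d, !a, b, c, ?_⟩
      cases a <;> simp [extremalPerm, ← mul_assoc, hE]
  · rintro ⟨d, a, b, c, rfl⟩
    have h₀ : HasExtremalForm n hn (extremalPerm hn d false false false) := by
      cases d
      · simpa [extremalPerm] using HasExtremalForm.floor (n := n) (hn := hn)
      · simpa [extremalPerm] using HasExtremalForm.ceil (n := n) (hn := hn)
    have h₁ : HasExtremalForm n hn (extremalPerm hn d a false false) := by
      cases a
      · exact h₀
      · simpa [extremalPerm] using h₀.swapValues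
    have h₂ : HasExtremalForm n hn (extremalPerm hn d a b false) := by
      cases b
      · exact h₁
      · simpa [extremalPerm] using h₁.swapEnds
    cases c
    · exact h₂
    · simpa [extremalPerm] using h₂.reverse

/-- The permutations of extremal form. -/
def extremalPerms : Finset (Perm (Fin n)) :=
  univ.image fun t : Bool × Bool × Bool × Bool => extremalPerm hn t.1 t.2.1 t.2.2.1 t.2.2.2

theorem mem_extremalPerms : π ∈ extremalPerms hn ↔ HasExtremalForm n hn π := by
  simp [extremalPerms, hasExtremalForm_iff]

/-- Interchanging the extreme values does not affect a value strictly between them. -/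
theorem extremalPerm_apply (d a b c : Bool) {i j : Fin n} {v : ℕ}
    (hj : (bif b then endsSwap n hn else 1) ((bif c then Fin.revPerm else 1 : Perm (Fin n)) i) = j)
    (hv : (if (j : ℕ) < n - (n + d.toNat) / 2 then (n + d.toNat) / 2 + j
      else j - (n - (n + d.toNat) / 2)) = v) (h0 : 0 < v) (h1 : v < n - 1) :
    (extremalPerm hn d a b c i : ℕ) = v := by
  rw [extremalPerm, Perm.mul_apply, Perm.mul_apply, Perm.mul_apply, hj]
  have hb := blockPerm_apply (n := n) (m := (n + d.toNat) / 2)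
    (by have := d.toNat_le; omega) j
  rw [hv] at hb
  cases a
  · exact hb
  · rw [cond_true, endsSwap, swap_apply_of_ne_of_ne, hb]
    · exact fun h => by rw [h] at hb; simp only at hb; omega
    · exact fun h => by rw [h] at hb; simp only at hb; omega

section Values

variable (h6 : 6 ≤ n) (d a b c : Bool)

include h6

theorem extremalPerm_first : (extremalPerm hn d a b c (first hn) : ℕ) =
    (n + d.toNat) / 2 - if b = c then 0 else 1 := by
  have hd := d.toNat_le
  refine extremalPerm_apply hn d a b c (j := if b = c then first hn else last hn) ?_ ?_ ?_ ?_
  · have h₁ : (first hn).rev = last hn := Fin.ext (by simp [Fin.val_rev])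
    cases b <;> cases c <;> simp [endsSwap, h₁]
  all_goals
    by_cases h : b = c <;> simp only [h, if_true, if_false] <;> try split_ifs
    all_goals omega

theorem extremalPerm_last : (extremalPerm hn d a b c (last hn) : ℕ) =
    (n + d.toNat) / 2 - if b = c then 1 else 0 := by
  have hd := d.toNat_le
  refine extremalPerm_apply hn d a b c (j := if b = c then last hn else first hn) ?_ ?_ ?_ ?_
  · have h₁ : (last hn).rev = first hn := Fin.ext (by simp [Fin.val_rev]; omega)
    cases b <;> cases c <;> simp [endsSwap, h₁]
  all_goals
    by_cases h : b = c <;> simp only [h, if_true, if_false] <;> try split_ifs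
    all_goals omega

theorem extremalPerm_second : (extremalPerm hn d a b c ⟨1, by omega⟩ : ℕ) =
    if c then (n + d.toNat) / 2 - 2 else (n + d.toNat) / 2 + 1 := by
  have hd := d.toNat_le
  refine extremalPerm_apply hn d a b c
    (j := if c then ⟨n - 2, by omega⟩ else ⟨1, by omega⟩) ?_ ?_ ?_ ?_
  · have h₁ : (⟨1, by omega⟩ : Fin n).rev = ⟨n - 2, by omega⟩ :=
      Fin.ext (by simp [Fin.val_rev])
    have h₂ : endsSwap n hn ⟨1, by omega⟩ = ⟨1, by omega⟩ :=
      swap_apply_of_ne_of_ne (by simp) (by simp; omega)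
    have h₃ : endsSwap n hn ⟨n - 2, by omega⟩ = ⟨n - 2, by omega⟩ :=
      swap_apply_of_ne_of_ne (by simp; omega) (by simp; omega)
    cases b <;> cases c <;> simp [h₁, h₂, h₃]
  all_goals
    cases c <;> simp only [if_true, Bool.false_eq_true, if_false] <;> try split_ifs
    all_goals omega

end Values

theorem extremalPerm_injective (h6 : 6 ≤ n) {d d' a a' b b' c c' : Bool}
    (h : extremalPerm hn d a b c = extremalPerm hn d' a' b' c') :
    (n + d.toNat) / 2 = (n + d'.toNat) / 2 ∧ a = a' ∧ b = b' ∧ c = c' := by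
  have h₁ := congrArg (fun π : Perm (Fin n) => (π (first hn) : ℕ)) h
  have h₂ := congrArg (fun π : Perm (Fin n) => (π (last hn) : ℕ)) h
  have h₃ := congrArg (fun π : Perm (Fin n) => (π ⟨1, by omega⟩ : ℕ)) h
  simp only [extremalPerm_first hn h6, extremalPerm_last hn h6, extremalPerm_second hn h6]
    at h₁ h₂ h₃
  have hd := d.toNat_le
  have hd' := d'.toNat_le
  have hm : (n + d.toNat) / 2 = (n + d'.toNat) / 2 := by
    split_ifs at h₁ h₂ <;> omega
  have hc : c = c' := by
    rw [hm] at h₃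
    cases c <;> cases c' <;> simp at h₃ ⊢ <;> omega
  subst hc
  have hb : b = b' := by
    rw [hm] at h₁
    cases b <;> cases b' <;> cases c <;> simp at h₁ ⊢ <;> omega
  subst hb
  refine ⟨hm, ?_, rfl, rfl⟩
  unfold extremalPerm at h
  simp only [hm] at h
  have h' := mul_right_cancel (mul_right_cancel (mul_right_cancel h))
  have hne : endsSwap n hn ≠ 1 := by
    rw [endsSwap, Ne, swap_eq_one_iff, Fin.mk.injEq]
    omega
  cases a <;> cases a' <;> simp [hne, hne.symm] at h' ⊢

theorem card_extremalPerms : (extremalPerms hn).card =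
    if n = 2 then 2 else if n = 3 ∨ n = 4 then 4 else if Even n then 8 else 16 := by
  rcases Nat.lt_or_ge n 6 with h | h6
  · interval_cases n
    -- for `n ≤ 4` different choices give the same permutation
    · exact (by decide +kernel :
        (extremalPerms (n := 2) (Nat.le_of_ble_eq_true rfl)).card = 2)
    · exact (by decide +kernel :
        (extremalPerms (n := 3) (Nat.le_of_ble_eq_true rfl)).card = 4)
    · exact (by decide +kernel :
        (extremalPerms (n := 4) (Nat.le_of_ble_eq_true rfl)).card = 4)
    · exact (by decide +kernel :
        (extremalPerms (n := 5) (Nat.le_of_ble_eq_true rfl)).card = 16)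
  · rw [if_neg (by omega), if_neg (by omega)]
    split_ifs with he
    · have h₁ : extremalPerms hn = univ.image fun t : Bool × Bool × Bool =>
          extremalPerm hn false t.1 t.2.1 t.2.2 := by
        ext π
        simp only [extremalPerms, mem_image, mem_univ, true_and, Prod.exists, Bool.exists_bool]
        have : ∀ a b c, extremalPerm hn true a b c = extremalPerm hn false a b c := by
          intro a b c
          have : (n + 1) / 2 = n / 2 := by
            obtain ⟨k, rfl⟩ := he
            omega
          simp [extremalPerm, this]
        simp [this]
      rw [h₁, card_image_of_injective]
      · rfl
      · intro t t' h
        have := extremalPerm_injective hn h6 h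
        exact Prod.ext this.2.1 (Prod.ext this.2.2.1 this.2.2.2)
    · rw [extremalPerms, card_image_of_injective]
      · rfl
      · intro t t' h
        have := extremalPerm_injective hn h6 h
        refine Prod.ext ?_ (Prod.ext this.2.1 (Prod.ext this.2.2.1 this.2.2.2))
        rw [Nat.not_even_iff_odd] at he
        obtain ⟨k, rfl⟩ := he
        have := this.1
        cases h : t.1 <;> cases h' : t'.1 <;> simp [h, h'] at this ⊢ <;> omega

/-- For `n ≤ 3` the permutations outside the family are the two monotone ones of `S_3`, whose middle
point separates the first from the last. -/
theorem hasExtremalForm_of_totalDegree (h : totalDegree π = edgeBound n) :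
    HasExtremalForm n hn π := by
  rcases Nat.lt_or_ge n 4 with h4 | h4
  · rw [← mem_extremalPerms]
    have hadj := (adj_first_last hn h).2
    interval_cases n
    · have key : ∀ π : Perm (Fin 2), π ∈ extremalPerms (n := 2) le_rfl := by decide +kernel
      exact key π
    · have key : ∀ π : Perm (Fin 3), π ∈ extremalPerms (n := 3) (Nat.le_succ 2) ∨
          (π 0 < π 1 ∧ π 1 < π 2) ∨ (π 2 < π 1 ∧ π 1 < π 0) := by
        decide +kernel
      refine (key π).resolve_right fun hc => hadj 1 (mem_univ _) (Or.inl (by simp [pos])) ?_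
      have h₂ : last hn = 2 := rfl
      have h₀ : first hn = 0 := rfl
      rw [h₀, h₂]
      simp only [Between, val]
      omega
  · rcases oriented_or_oriented_reverse hn h4 h with ho | ho
    · exact hasExtremalForm_of_oriented hn h4 h ho
    · have := (hasExtremalForm_of_oriented hn h4 (by rw [totalDegree_mul_revPerm, h]) ho).reverse
      rwa [mul_assoc, revPerm_mul_self, mul_one] at this

theorem totalDegree_eq_iff : totalDegree π = edgeBound n ↔ HasExtremalForm n hn π :=
  ⟨hasExtremalForm_of_totalDegree hn, totalDegree_of_hasExtremalForm hn⟩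

end Family

end StrongBruhat

theorem theorem3p2 (n : ℕ) (hn : 2 ≤ n) :
    {π : Equiv.Perm (Fin n) | StrongBruhat.totalDegree π = n ^ 2 / 4 + n - 2}.ncard =
        (if n = 2 then 2
        else if n = 3 ∨ n = 4 then 4
        else if Even n then 8
        else 16) ∧
      (∀ π : Equiv.Perm (Fin n),
        StrongBruhat.totalDegree π = n ^ 2 / 4 + n - 2 ↔ StrongBruhat.HasExtremalForm n hn π) ∧
      (∀ π : Equiv.Perm (Fin n),
        StrongBruhat.IsExtremal π ↔ StrongBruhat.HasExtremalForm n hn π) := by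
  have hiff : ∀ π : Equiv.Perm (Fin n), StrongBruhat.totalDegree π = n ^ 2 / 4 + n - 2 ↔
      StrongBruhat.HasExtremalForm n hn π := fun π => StrongBruhat.totalDegree_eq_iff hn
  refine ⟨?_, hiff, fun π => ⟨fun h => ?_, fun h σ => ?_⟩⟩
  · rw [← StrongBruhat.card_extremalPerms hn, ← Set.ncard_coe_finset]
    congr 1
    ext π
    rw [Set.mem_ofPred_eq, hiff, Finset.mem_coe, StrongBruhat.mem_extremalPerms]
  · refine (hiff π).1 (le_antisymm (StrongBruhat.totalDegree_le hn π) ?_)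
    exact ((hiff _).2 .floor).ge.trans (h _)
  · exact (StrongBruhat.totalDegree_le hn σ).trans ((hiff π).2 h).ge
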